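/- Let $\mathcal C$ be a hereditary abelian category, i.e. an abelian category such that $\operatorname{Ext}^i_{\mathcal C}(X,Y)=\operatorname{Hom}_{D(\mathcal C)}(X,\Sigma^iY)=0$ for all $X,Y\in\mathcal C$ and all $i\ge 2$, and let $m\ge 0$ be an integer. Let $\mathcal C[0,m]$ be the full subcategory of the bounded derived category $D^b(\mathcal C)$ whose objects are the $X$ with $H_s(X)=0$ for every integer $s\notin\{0,\dots,m\}$, where $H_s=H^{-s}$ denotes homology in homological grading (so that $\Sigma^sA$ has homology concentrated in degree $s$ for $A\in\mathcal C$). Then $\mathcal C[0,m]$ is a $(3m+1)$-abelian category in the sense of Jasso. Here, for a positive integer $d$, a $d$-cokernel of a morphism $f_0\colon X_0\to X_1$ in an additive category $\mathcal M$ is a sequence $X_1\xrightarrow{f_1}X_2\to\cdots\xrightarrow{f_d}X_{d+1}$ such that $0\to\mathcal M(X_{d+1},Y)\to\mathcal M(X_d,Y)\to\cdots\to\mathcal M(X_1,Y)\to\mathcal M(X_0,Y)$ is exact for every $Y\in\mathcal M$; $d$-kernels are defined dually; and a sequence $X_0\xrightarrow{f_0}X_1\to\cdots\to X_d\xrightarrow{f_d}X_{d+1}$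 is $d$-exact if $(f_1,\dots,f_d)$ is a $d$-cokernel of $f_0$ and $(f_0,\dots,f_{d-1})$ is a $d$-kernel of $f_d$. The category $\mathcal M$ is $d$-abelian if it is additive and idempotent complete, every morphism in it has a $d$-kernel and a $d$-cokernel, for every monomorphism $f_0$ and every $d$-cokernel $(f_1,\dots,f_d)$ of $f_0$ the sequence $(f_0,f_1,\dots,f_d)$ is $d$-exact, and for every epimorphism $f_d$ and every $d$-kernel $(f_0,\dots,f_{d-1})$ of $f_d$ the sequence $(f_0,\dots,f_{d-1},f_d)$ is $d$-exact. -/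

import Mathlib

open CategoryTheory CategoryTheory.Limits

universe w v u

-- Morphisms are always taken in the quiver underlying a category.
attribute [-instance] catToReflQuiver

/-- A sequence `X₀ ⟶ X₁ ⟶ ⋯ ⟶ X_{d+1}` (with morphisms `f₀, …, f_d`) exhibits `(f₁, …, f_d)`
as a `d`-cokernel of `f₀`: for every object `Y`, the induced sequence of abelian groups
`0 ⟶ Hom(X_{d+1}, Y) ⟶ Hom(X_d, Y) ⟶ ⋯ ⟶ Hom(X₁, Y) ⟶ Hom(X₀, Y)` is exact. -/
structure IsDCokernelSeq {M : Type u} [Category.{v} M] [Preadditive M] {d : ℕ}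
    (S : ComposableArrows M (d + 1)) : Prop where
  /-- exactness at `Hom(X_{d+1}, Y)` -/
  injective : ∀ Y : M, Function.Injective
    (fun h : S.obj' (d + 1) ⟶ Y => S.map' d (d + 1) ≫ h)
  /-- exactness at `Hom(X_{k+1}, Y)`, for `k + 1 = 1, …, d` -/
  exact : ∀ (Y : M) (k : ℕ) (hk : k < d), Function.Exact
    (fun h : S.obj' (k + 2) ⟶ Y => S.map' (k + 1) (k + 2) ≫ h)
    (fun g : S.obj' (k + 1) ⟶ Y => S.map' k (k + 1) ≫ g)

/-- A sequence `X₀ ⟶ X₁ ⟶ ⋯ ⟶ X_{d+1}` (with morphisms `f₀, …, f_d`) exhibits `(f₀, …, f_{d-1})`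
as a `d`-kernel of `f_d`: for every object `Y`, the induced sequence of abelian groups
`0 ⟶ Hom(Y, X₀) ⟶ Hom(Y, X₁) ⟶ ⋯ ⟶ Hom(Y, X_d) ⟶ Hom(Y, X_{d+1})` is exact. -/
structure IsDKernelSeq {M : Type u} [Category.{v} M] [Preadditive M] {d : ℕ}
    (S : ComposableArrows M (d + 1)) : Prop where
  /-- exactness at `Hom(Y, X₀)` -/
  injective : ∀ Y : M, Function.Injective (fun h : Y ⟶ S.obj' 0 => h ≫ S.map' 0 1)
  /-- exactness at `Hom(Y, X_{k+1})`, for `k + 1 = 1, …, d` -/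
  exact : ∀ (Y : M) (k : ℕ) (hk : k < d), Function.Exact
    (fun h : Y ⟶ S.obj' k => h ≫ S.map' k (k + 1))
    (fun g : Y ⟶ S.obj' (k + 1) => g ≫ S.map' (k + 1) (k + 2))

/-- A sequence `X₀ ⟶ X₁ ⟶ ⋯ ⟶ X_{d+1}` is `d`-exact. -/
structure IsDExactSeq {M : Type u} [Category.{v} M] [Preadditive M] {d : ℕ}
    (S : ComposableArrows M (d + 1)) : Prop where
  isDCokernelSeq : IsDCokernelSeq S
  isDKernelSeq : IsDKernelSeq S

/-- `d`-abelian categories, for a positive integer `d` (in the sense of Jasso). The fields `pos`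
and `hasFiniteBiproducts` say that `d` is positive and that `M` is an additive category. -/
structure IsDAbelian (d : ℕ) (M : Type u) [Category.{v} M] [Preadditive M] : Prop where
  pos : 0 < d
  hasFiniteBiproducts : HasFiniteBiproducts M
  idempotentComplete : IsIdempotentComplete M
  exists_dKernel : ∀ {X Y : M} (f : X ⟶ Y), ∃ S : ComposableArrows M (d + 1),
    Arrow.mk (S.map' d (d + 1)) = Arrow.mk f ∧ IsDKernelSeq S
  exists_dCokernel : ∀ {X Y : M} (f : X ⟶ Y), ∃ S : ComposableArrows M (d + 1),
    Arrow.mk (S.map' 0 1) = Arrow.mk f ∧ IsDCokernelSeq S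
  isDExactSeq_of_mono : ∀ S : ComposableArrows M (d + 1),
    Mono (S.map' 0 1) → IsDCokernelSeq S → IsDExactSeq S
  isDExactSeq_of_epi : ∀ S : ComposableArrows M (d + 1),
    Epi (S.map' d (d + 1)) → IsDKernelSeq S → IsDExactSeq S

/-- An abelian category is hereditary if `Ext^i(X, Y) = 0` for all objects `X`, `Y` and all
`i ≥ 2`. Here `Ext^i(X, Y)` is the group of morphisms `X ⟶ Y[i]` in the derived category. -/
def IsHereditary (C : Type u) [Category.{v} C] [Abelian C] : Prop :=
  letI : HasExt.{max u v} C := HasExt.standard C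
  ∀ (X Y : C) (i : ℕ), 2 ≤ i → Subsingleton (Abelian.Ext.{max u v} X Y i)

/-- The property of objects `X` of `D^b(C)` that `H_s(X) = 0` unless `i ≤ s ≤ j`. The grading is
homological: `H_s = H^{-s}`, so that an object `A` of `C` yields an object `A[s]` with homology
concentrated in degree `s`. -/
def homologyConcentrated (C : Type u) [Category.{v} C] [Abelian C] [HasDerivedCategory.{w} C]
    (i j : ℤ) : ObjectProperty (DerivedCategory.Bounded C) :=
  fun X => ∀ s : ℤ, ¬ (i ≤ s ∧ s ≤ j) →
    IsZero ((DerivedCategory.homologyFunctor C (-s)).obj X.obj)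

/-- The full subcategory `C[i, j]` of `D^b(C)` of the objects whose homology is concentrated in
degrees `s` with `i ≤ s ≤ j`. -/
abbrev TruncatedCategory (C : Type u) [Category.{v} C] [Abelian C] [HasDerivedCategory.{w} C]
    (i j : ℤ) :=
  (homologyConcentrated C i j).FullSubcategory

/-! Let `M` be the objects in a window `[a, a + m]` of a t-structure. For `f : X ⟶ Y` in `M` with
cone `Z`, the helix `X, Y, Z, X⟦1⟧, …` is exact under `Hom(-, V)`. Truncating each term to degrees
`≥ a` lands in `M` and keeps this exactness for `V ≥ a`. As `X⟦m + 1⟧` lies below the window, the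
sequence stops at position `3m + 2`: it is a `(3m + 1)`-cokernel, without any use of heredity
(`exists_weakCokernel_sequence`).

If `f` is mono, this sequence is also exact under `Hom(A, -)`. Heredity splits `A` into a part in
degree `a` and a part `≥ a + 1`, and lifts maps from `A` to a truncation back to the helix. On the
part `≥ a + 1` truncation changes nothing. On the part in degree `a`, the error terms lie below `a`
and are controlled by the injectivity of `f⟦k⟧` on maps from `[a - k, a + m - k]` (`lift₁`, `lift₂`,
`eq_zero₃`). Any other `d`-cokernel of `f` inherits exactness by a homotopy
(`isDKernelSeq_of_sequence`).

Kernels and epimorphisms follow from the opposite t-structure, and idempotents split by dévissage to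
shifts of objects of `C`. -/

namespace CategoryTheory.Triangulated

open Pretriangulated

/-! ### Distinguished triangles and their helices -/

section

variable {𝒯 : Type*} [Category* 𝒯] [Preadditive 𝒯] [HasZeroObject 𝒯] [HasShift 𝒯 ℤ]
  [∀ n : ℤ, (shiftFunctor 𝒯 n).Additive] [Pretriangulated 𝒯]

section

variable {X Y Z : 𝒯} {f : X ⟶ Y} {g : Y ⟶ Z} {h : Z ⟶ X⟦(1 : ℤ)⟧}

lemma exists_desc₂ (hT : Triangle.mk f g h ∈ distTriang 𝒯) {A : 𝒯}
    (u : Y ⟶ A) (hu : f ≫ u = 0) : ∃ v : Z ⟶ A, g ≫ v = u := by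
  obtain ⟨v, hv⟩ := Triangle.yoneda_exact₂ _ hT u hu
  exact ⟨v, hv.symm⟩

lemma exists_desc₃ (hT : Triangle.mk f g h ∈ distTriang 𝒯) {A : 𝒯}
    (u : Z ⟶ A) (hu : g ≫ u = 0) : ∃ v : X⟦(1 : ℤ)⟧ ⟶ A, h ≫ v = u := by
  obtain ⟨v, hv⟩ := Triangle.yoneda_exact₃ _ hT u hu
  exact ⟨v, hv.symm⟩

/-- Exactness is read off the rotated triangle after shifting `u`, whence the sign. -/
lemma exists_desc₁ (hT : Triangle.mk f g h ∈ distTriang 𝒯) {A : 𝒯}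
    (u : X ⟶ A) (hu : h ≫ u⟦(1 : ℤ)⟧' = 0) : ∃ v : Y ⟶ A, f ≫ v = u := by
  obtain ⟨x, hx⟩ : ∃ x : Y⟦(1 : ℤ)⟧ ⟶ A⟦(1 : ℤ)⟧, u⟦(1 : ℤ)⟧' = (-f⟦(1 : ℤ)⟧') ≫ x :=
    Triangle.yoneda_exact₃ _ (rot_of_distTriang _ hT) (u⟦(1 : ℤ)⟧') hu
  obtain ⟨x', rfl⟩ := (shiftFunctor 𝒯 (1 : ℤ)).map_surjective x
  refine ⟨-x', (shiftFunctor 𝒯 (1 : ℤ)).map_injective ?_⟩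
  rw [hx]
  simp

lemma exists_lift₂ (hT : Triangle.mk f g h ∈ distTriang 𝒯) {A : 𝒯}
    (u : A ⟶ Y) (hu : u ≫ g = 0) : ∃ v : A ⟶ X, v ≫ f = u := by
  obtain ⟨v, hv⟩ := Triangle.coyoneda_exact₂ _ hT u hu
  exact ⟨v, hv.symm⟩

lemma exists_lift₃ (hT : Triangle.mk f g h ∈ distTriang 𝒯) {A : 𝒯}
    (u : A ⟶ Z) (hu : u ≫ h = 0) : ∃ v : A ⟶ Y, v ≫ g = u := by
  obtain ⟨v, hv⟩ := Triangle.coyoneda_exact₃ _ hT u hu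
  exact ⟨v, hv.symm⟩

end

/-- The iterated rotations of a triangle. -/
def iteratedRotate (T : Triangle 𝒯) : ℕ → Triangle 𝒯
  | 0 => T
  | n + 1 => (iteratedRotate T n).rotate

/-- The objects `X, Y, Z, X⟦1⟧, Y⟦1⟧, …` of the helix of a triangle `X ⟶ Y ⟶ Z ⟶ X⟦1⟧`. -/
def helixObj (T : Triangle 𝒯) (n : ℕ) : 𝒯 := (iteratedRotate T n).obj₁

/-- The morphisms of the helix of a triangle. -/
def helixMap (T : Triangle 𝒯) (n : ℕ) : helixObj T n ⟶ helixObj T (n + 1) :=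
  (iteratedRotate T n).mor₁

lemma iteratedRotate_distinguished {T : Triangle 𝒯} (hT : T ∈ distTriang 𝒯) (n : ℕ) :
    iteratedRotate T n ∈ distTriang 𝒯 := by
  induction n with
  | zero => exact hT
  | succ n ih => exact rot_of_distTriang _ ih

lemma helixMap_comp {T : Triangle 𝒯} (hT : T ∈ distTriang 𝒯) (n : ℕ) :
    helixMap T n ≫ helixMap T (n + 1) = 0 :=
  comp_distTriang_mor_zero₁₂ _ (iteratedRotate_distinguished hT n)

lemma helix_yoneda_exact {T : Triangle 𝒯} (hT : T ∈ distTriang 𝒯) (n : ℕ) {Z : 𝒯}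
    (f : helixObj T (n + 1) ⟶ Z) (hf : helixMap T n ≫ f = 0) :
    ∃ g : helixObj T (n + 2) ⟶ Z, f = helixMap T (n + 1) ≫ g :=
  Triangle.yoneda_exact₂ _ (iteratedRotate_distinguished hT n) f hf

lemma helix_coyoneda_exact {T : Triangle 𝒯} (hT : T ∈ distTriang 𝒯) (n : ℕ) {Z : 𝒯}
    (f : Z ⟶ helixObj T (n + 1)) (hf : f ≫ helixMap T (n + 1) = 0) :
    ∃ g : Z ⟶ helixObj T n, f = g ≫ helixMap T n :=
  Triangle.coyoneda_exact₂ _ (iteratedRotate_distinguished hT n) f hf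

/-- If `y` followed by a map of the helix factors through `g` as `g ≫ k`, then `y` itself factors
through `g` as soon as a suitable map of the helix is injective on morphisms from the cone of `g`. -/
lemma helix_factor_of_cone {T : Triangle 𝒯} (hT : T ∈ distTriang 𝒯) (n : ℕ)
    {A G N : 𝒯} {g : A ⟶ G} {p : G ⟶ N} {δ : N ⟶ A⟦(1 : ℤ)⟧}
    (hD : Triangle.mk g p δ ∈ distTriang 𝒯) (y : A ⟶ helixObj T n)
    (k : G ⟶ helixObj T (n + 1)) (comm : g ≫ k = y ≫ helixMap T n)
    (H : ∀ c : N ⟶ helixObj T (n + 3), c ≫ helixMap T (n + 3) = 0 → c = 0) :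
    ∃ x : G ⟶ helixObj T n, g ≫ x = y := by
  -- `y` extends along `g` once `δ ≫ y⟦1⟧'` vanishes; completing `(y, k)` to a morphism of triangles
  -- rewrites this through `c`.
  obtain ⟨c, -, hc⟩ : ∃ c : N ⟶ helixObj T (n + 2), p ≫ c = k ≫ helixMap T (n + 1) ∧
      (δ ≫ y⟦(1 : ℤ)⟧' : N ⟶ helixObj T (n + 3)) = c ≫ helixMap T (n + 2) :=
    complete_distinguished_triangle_morphism _ (iteratedRotate T n) hD
      (iteratedRotate_distinguished hT n) y k comm
  have h0 : c ≫ helixMap T (n + 2) = 0 :=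
    H _ (by rw [Category.assoc, helixMap_comp hT, comp_zero])
  exact exists_desc₁ hD y (hc.trans h0)

/-! ### Truncations for hereditary t-structures -/

namespace TStructure

variable (t : TStructure 𝒯)

/-- A t-structure is hereditary if there is no nonzero morphism from a bounded object `≥ n + 1`
to a bounded object `≤ n - 1`. -/
def IsHereditary : Prop :=
  ∀ ⦃X Y : 𝒯⦄ (f : X ⟶ Y) (n a b : ℤ), t.IsGE X (n + 1) → t.IsLE X b →
    t.IsLE Y (n - 1) → t.IsGE Y a → f = 0

variable {t}

section

variable {X Y Z : 𝒯} {f : X ⟶ Y} {g : Y ⟶ Z} {h : Z ⟶ X⟦(1 : ℤ)⟧}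

lemma isLE_obj₃ (hT : Triangle.mk f g h ∈ distTriang 𝒯) (n : ℤ)
    (h₁ : t.IsLE X (n + 1)) (h₂ : t.IsLE Y n) : t.IsLE Z n :=
  t.isLE₂ _ (rot_of_distTriang _ hT) n h₂ (t.isLE_shift X (n + 1) 1 n)

lemma isGE_obj₃ (hT : Triangle.mk f g h ∈ distTriang 𝒯) (n : ℤ)
    (h₁ : t.IsGE X (n + 1)) (h₂ : t.IsGE Y n) : t.IsGE Z n :=
  t.isGE₂ _ (rot_of_distTriang _ hT) n h₂ (t.isGE_shift X (n + 1) 1 n)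

lemma isGE_obj₁ (hT : Triangle.mk f g h ∈ distTriang 𝒯) (n : ℤ)
    (h₂ : t.IsGE Y n) (h₃ : t.IsGE Z (n - 1)) : t.IsGE X n :=
  t.isGE₂ _ (inv_rot_of_distTriang _ hT) n (t.isGE_shift Z (n - 1) (-1) n) h₂

end

variable (t) in
/-- A morphism `r : W ⟶ V` whose fibre is `≤ a - 1`. If `V` is `≥ a`, this means that `V` is
the truncation of `W`. -/
def IsTruncation (a : ℤ) {W V : 𝒯} (r : W ⟶ V) : Prop :=
  ∃ (G : 𝒯) (i : G ⟶ W) (δ : V ⟶ G⟦(1 : ℤ)⟧), Triangle.mk i r δ ∈ distTriang 𝒯 ∧ t.IsLE G (a - 1)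

/-- Lets a truncated helix begin with `X` and `Y` themselves. -/
lemma isTruncation_id (a : ℤ) (W : 𝒯) : t.IsTruncation a (𝟙 W) :=
  ⟨_, _, _, contractible_distinguished₁ W, t.isLE_of_isZero (isZero_zero _) _⟩

lemma isTruncation_truncGEπ (a : ℤ) (W : 𝒯) : t.IsTruncation a ((t.truncGEπ a).app W) :=
  ⟨_, _, _, t.triangleLTGE_distinguished a W, inferInstance⟩

namespace IsTruncation

variable {a : ℤ} {W V : 𝒯} {r : W ⟶ V}

lemma comp_iso (hr : t.IsTruncation a r) {V' : 𝒯} (e : V ≅ V') : t.IsTruncation a (r ≫ e.hom) := by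
  obtain ⟨G, i, δ, hT, hG⟩ := hr
  refine ⟨G, i, e.inv ≫ δ, isomorphic_distinguished _ hT _ ?_, hG⟩
  exact Triangle.isoMk _ _ (Iso.refl _) (Iso.refl _) e.symm
    (show i ≫ 𝟙 W = 𝟙 G ≫ i by simp) (show (r ≫ e.hom) ≫ e.inv = 𝟙 W ≫ r by simp)
    (show (e.inv ≫ δ) ≫ (𝟙 G)⟦(1 : ℤ)⟧' = e.inv ≫ δ by simp)

lemma desc (hr : t.IsTruncation a r) {Z : 𝒯} (hZ : t.IsGE Z a) (f : W ⟶ Z) :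
    ∃ g : V ⟶ Z, r ≫ g = f := by
  obtain ⟨G, i, δ, hT, hG⟩ := hr
  exact exists_desc₂ hT f (t.zero _ (a - 1) a)

lemma hom_ext (hr : t.IsTruncation a r) {Z : 𝒯} (hZ : t.IsGE Z a) {g : V ⟶ Z} (hg : r ≫ g = 0) :
    g = 0 := by
  obtain ⟨G, i, δ, hT, hG⟩ := hr
  obtain ⟨g', rfl⟩ := exists_desc₃ hT g hg
  have : t.IsLE (G⟦(1 : ℤ)⟧) (a - 2) := t.isLE_shift G (a - 1) 1 (a - 2)
  have : g' = 0 := t.zero _ (a - 2) a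
  rw [this, comp_zero]

/-- The obstruction lies in `Hom(A, G⟦1⟧)` with `G⟦1⟧ ≤ a - 2`, which heredity kills; `c` only
serves to bound `G⟦1⟧` below. -/
lemma lift (hr : t.IsTruncation a r) (ht : t.IsHereditary) {c : ℤ} (hW : t.IsGE W c)
    (hV : t.IsGE V a) {b : ℤ} {A : 𝒯} (hA : t.IsGE A a) (hA' : t.IsLE A b) (y : A ⟶ V) :
    ∃ y' : A ⟶ W, y' ≫ r = y := by
  obtain ⟨G, i, δ, hT, hG⟩ := hr
  have : t.IsLE (G⟦(1 : ℤ)⟧) (a - 1 - 1) := t.isLE_shift G (a - 1) 1 (a - 1 - 1)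
  have : t.IsGE G (min c (a + 1)) := isGE_obj₁ hT _ (t.isGE_of_ge W _ c)
    (t.isGE_of_ge V _ a)
  have : t.IsGE (G⟦(1 : ℤ)⟧) (min c (a + 1) - 1) := t.isGE_shift G (min c (a + 1)) 1 _
  exact exists_lift₃ hT y (ht _ (a - 1) (min c (a + 1) - 1) b (by simpa) hA' ‹_› ‹_›)

lemma factor (hr : t.IsTruncation a r) {c : ℤ} (hc : c ≤ a + 1) (hW : t.IsGE W c)
    (hV : t.IsGE V a) {A : 𝒯} (y : A ⟶ W) (hy : y ≫ r = 0) :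
    ∃ (G : 𝒯) (g : A ⟶ G) (h : G ⟶ W), t.IsLE G (a - 1) ∧ t.IsGE G c ∧ g ≫ h = y := by
  obtain ⟨G, i, δ, hT, hG⟩ := hr
  obtain ⟨g, hg⟩ := exists_lift₂ hT y hy
  exact ⟨G, g, i, hG, isGE_obj₁ hT _ hW (t.isGE_of_ge V _ a), hg⟩

lemma eq_zero (hr : t.IsTruncation a r) (ht : t.IsHereditary) {c : ℤ} (hW : t.IsGE W c)
    (hV : t.IsGE V a) {b : ℤ} {A : 𝒯} (hA : t.IsGE A (a + 1)) (hA' : t.IsLE A b) (y : A ⟶ W)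
    (hy : y ≫ r = 0) : y = 0 := by
  have : t.IsGE W (min c (a + 1)) := t.isGE_of_ge W _ c
  obtain ⟨G, g, h, hG, hG', rfl⟩ := hr.factor (c := min c (a + 1)) (by simp) this hV y hy
  rw [ht g a _ _ hA hA' hG hG', zero_comp]

end IsTruncation

/-- A morphism out of `A` to be lifted along `e` may be lifted on the two pieces of a truncation
triangle of `A`, if the t-structure is hereditary. -/
lemma exists_lift_of_truncation (ht : t.IsHereditary) {a b : ℤ} {A : 𝒯} (hA : t.IsGE A a)
    (hA' : t.IsLE A b) {E₀ E₁ E₂ : 𝒯} (e₀ : E₀ ⟶ E₁) (e₁ : E₁ ⟶ E₂)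
    (H₁ : ∀ (B : 𝒯) (y : B ⟶ E₁), t.IsGE B a → t.IsLE B a → y ≫ e₁ = 0 → ∃ z, z ≫ e₀ = y)
    (H₂ : ∀ (B : 𝒯) (y : B ⟶ E₁), t.IsGE B (a + 1) → t.IsLE B b → y ≫ e₁ = 0 →
      ∃ z, z ≫ e₀ = y)
    (y : A ⟶ E₁) (hy : y ≫ e₁ = 0) : ∃ z, z ≫ e₀ = y := by
  obtain hb | hb := lt_or_ge b a
  · have := t.isZero A b a
    exact ⟨0, this.eq_of_src _ _⟩
  obtain ⟨A₁, A₂, h₁, h₂, i, q, δ, hT⟩ := t.exists_triangle A a (a + 1) rfl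
  have h₁ : t.IsLE A₁ a := ⟨h₁⟩
  have h₂ : t.IsGE A₂ (a + 1) := ⟨h₂⟩
  have h₁' : t.IsGE A₁ a := isGE_obj₁ hT _ hA (t.isGE_of_ge A₂ _ (a + 1))
  have h₂' : t.IsLE A₂ b := isLE_obj₃ hT _ (t.isLE_of_le A₁ a (b + 1)) hA'
  -- The connecting morphism goes from `≥ a + 1` to `≤ a - 1`, so the truncation triangle splits.
  have hδ : δ = 0 := ht δ a (a - 1) b h₂ h₂' (t.isLE_shift A₁ a 1 (a - 1))
    (t.isGE_shift A₁ a 1 (a - 1))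
  obtain ⟨s, hs⟩ := exists_lift₃ hT (𝟙 A₂) (by rw [hδ, comp_zero])
  obtain ⟨p, hp⟩ := exists_lift₂ hT (𝟙 A - q ≫ s) (by simp [Preadditive.sub_comp, hs])
  obtain ⟨z₁, hz₁⟩ := H₁ A₁ (i ≫ y) h₁' h₁ (by simp [hy])
  obtain ⟨z₂, hz₂⟩ := H₂ A₂ (s ≫ y) h₂ h₂' (by simp [hy])
  refine ⟨p ≫ z₁ + q ≫ z₂, ?_⟩
  rw [Preadditive.add_comp, Category.assoc, Category.assoc, hz₁, hz₂, ← Category.assoc, hp,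
    Preadditive.sub_comp, Category.id_comp, Category.assoc, sub_add_cancel]

end TStructure

end

end CategoryTheory.Triangulated

/-! ### Exactness of the truncated helix -/

namespace CategoryTheory.Triangulated

open Pretriangulated

namespace TStructure

variable {𝒯 : Type*} [Category* 𝒯] [Preadditive 𝒯] [HasZeroObject 𝒯] [HasShift 𝒯 ℤ]
  [∀ n : ℤ, (shiftFunctor 𝒯 n).Additive] [Pretriangulated 𝒯] {t : TStructure 𝒯}

section

variable {X Y Z : 𝒯} {f : X ⟶ Y} {g : Y ⟶ Z} {h : Z ⟶ X⟦(1 : ℤ)⟧} {a b : ℤ}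

lemma isLE_helixObj (hT : Triangle.mk f g h ∈ distTriang 𝒯)
    (hX : t.IsLE X b) (hY : t.IsLE Y b) (k : ℕ) :
    t.IsLE (helixObj (Triangle.mk f g h) (3 * k)) (b - k) ∧
      t.IsLE (helixObj (Triangle.mk f g h) (3 * k + 1)) (b - k) ∧
      t.IsLE (helixObj (Triangle.mk f g h) (3 * k + 2)) (b - k) := by
  induction k with
  | zero =>
    simp only [Nat.cast_zero, sub_zero]
    exact ⟨hX, hY, isLE_obj₃ hT b (t.isLE_of_le X b (b + 1)) hY⟩
  | succ k ih =>
    obtain ⟨h0, h1, h2⟩ := ih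
    have e : (1 : ℤ) + (b - (k + 1 : ℕ)) = b - k := by push_cast; ring
    exact ⟨t.isLE_shift (helixObj (Triangle.mk f g h) (3 * k)) (b - k) 1 _ e,
      t.isLE_shift (helixObj (Triangle.mk f g h) (3 * k + 1)) (b - k) 1 _ e,
      t.isLE_shift (helixObj (Triangle.mk f g h) (3 * k + 2)) (b - k) 1 _ e⟩

/-- The cone may reach one degree below `X` and `Y`, hence `a - 1 - k`. -/
lemma isGE_helixObj (hT : Triangle.mk f g h ∈ distTriang 𝒯)
    (hX : t.IsGE X a) (hY : t.IsGE Y a) (k : ℕ) :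
    t.IsGE (helixObj (Triangle.mk f g h) (3 * k)) (a - k) ∧
      t.IsGE (helixObj (Triangle.mk f g h) (3 * k + 1)) (a - k) ∧
      t.IsGE (helixObj (Triangle.mk f g h) (3 * k + 2)) (a - 1 - k) := by
  induction k with
  | zero =>
    simp only [Nat.cast_zero, sub_zero]
    exact ⟨hX, hY, isGE_obj₃ hT (a - 1) (by simpa using hX) (t.isGE_of_ge Y (a - 1) a)⟩
  | succ k ih =>
    obtain ⟨h0, h1, h2⟩ := ih
    have e : (1 : ℤ) + (a - (k + 1 : ℕ)) = a - k := by push_cast; ring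
    have e' : (1 : ℤ) + (a - 1 - (k + 1 : ℕ)) = a - 1 - k := by push_cast; ring
    exact ⟨t.isGE_shift (helixObj (Triangle.mk f g h) (3 * k)) (a - k) 1 _ e,
      t.isGE_shift (helixObj (Triangle.mk f g h) (3 * k + 1)) (a - k) 1 _ e,
      t.isGE_shift (helixObj (Triangle.mk f g h) (3 * k + 2)) (a - 1 - k) 1 _ e'⟩

lemma exists_isGE_helixObj (hT : Triangle.mk f g h ∈ distTriang 𝒯)
    (hX : t.IsGE X a) (hY : t.IsGE Y a) (n : ℕ) :
    ∃ c, t.IsGE (helixObj (Triangle.mk f g h) n) c := by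
  obtain ⟨k, rfl | rfl | rfl⟩ : ∃ k, n = 3 * k ∨ n = 3 * k + 1 ∨ n = 3 * k + 2 :=
    ⟨n / 3, by lia⟩
  · exact ⟨_, (isGE_helixObj hT hX hY k).1⟩
  · exact ⟨_, (isGE_helixObj hT hX hY k).2.1⟩
  · exact ⟨_, (isGE_helixObj hT hX hY k).2.2⟩

lemma isLE_helixObj_of_le (hT : Triangle.mk f g h ∈ distTriang 𝒯)
    (hX : t.IsLE X b) (hY : t.IsLE Y b) (n : ℕ) :
    t.IsLE (helixObj (Triangle.mk f g h) n) b := by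
  obtain ⟨k, rfl | rfl | rfl⟩ : ∃ k, n = 3 * k ∨ n = 3 * k + 1 ∨ n = 3 * k + 2 :=
    ⟨n / 3, by lia⟩
  · have := (isLE_helixObj hT hX hY k).1
    exact t.isLE_of_le _ (b - k) b
  · have := (isLE_helixObj hT hX hY k).2.1
    exact t.isLE_of_le _ (b - k) b
  · have := (isLE_helixObj hT hX hY k).2.2
    exact t.isLE_of_le _ (b - k) b

variable (t) in
/-- A morphism which is injective on morphisms from the objects that are `≥ a` and `≤ b`. -/
def IsMonoOn (a b : ℤ) (f : X ⟶ Y) : Prop :=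
  ∀ ⦃V : 𝒯⦄ (u : V ⟶ X), t.IsGE V a → t.IsLE V b → u ≫ f = 0 → u = 0

/-- The sign is the one that rotating a triangle introduces. -/
lemma IsMonoOn.shift (hf : t.IsMonoOn a b f) {a' b' : ℤ} (ha : a' + 1 = a) (hb : b' + 1 = b) :
    t.IsMonoOn a' b' (-f⟦(1 : ℤ)⟧') := by
  intro V u hV hV' hu
  let e : V⟦(-1 : ℤ)⟧⟦(1 : ℤ)⟧ ≅ V := (shiftEquiv 𝒯 (1 : ℤ)).counitIso.app V
  obtain ⟨u', hu'⟩ := (shiftFunctor 𝒯 (1 : ℤ)).map_surjective (e.hom ≫ u)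
  have : u' = 0 := hf u' (t.isGE_shift V a' (-1) a) (t.isLE_shift V b' (-1) b) (by
    apply (shiftFunctor 𝒯 (1 : ℤ)).map_injective
    rw [Functor.map_comp, hu', Category.assoc, Functor.map_zero]
    rw [Preadditive.comp_neg, neg_eq_zero] at hu
    rw [hu, comp_zero])
  rw [this, Functor.map_zero] at hu'
  rw [← cancel_epi e.hom, ← hu', comp_zero]

lemma IsMonoOn.helixMap (hf : t.IsMonoOn a b f) (k : ℕ) :
    t.IsMonoOn (a - k) (b - k) (helixMap (Triangle.mk f g h) (3 * k)) := by
  induction k with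
  | zero =>
    simp only [Nat.cast_zero, sub_zero]
    exact hf
  | succ k ih => exact ih.shift (by push_cast; ring) (by push_cast; ring)

end

section

variable {X Y Z : 𝒯} {f : X ⟶ Y} {g : Y ⟶ Z} {h : Z ⟶ X⟦(1 : ℤ)⟧} {a b : ℤ}
  {E : ℕ → 𝒯} {e : ∀ n, E n ⟶ E (n + 1)} {r : ∀ n, helixObj (Triangle.mk f g h) n ⟶ E n}

variable (t f g h a e r) in
/-- A sequence which is obtained by truncating the helix of a triangle. -/
structure IsTruncatedHelix : Prop where
  distinguished : Triangle.mk f g h ∈ distTriang 𝒯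
  isTruncation (n : ℕ) : t.IsTruncation a (r n)
  isGE (n : ℕ) : t.IsGE (E n) a
  comm (n : ℕ) : r n ≫ e n = helixMap (Triangle.mk f g h) n ≫ r (n + 1)

namespace IsTruncatedHelix

lemma comp (H : t.IsTruncatedHelix f g h a e r) (n : ℕ) : e n ≫ e (n + 1) = 0 := by
  refine (H.isTruncation n).hom_ext (H.isGE _) ?_
  rw [← Category.assoc, H.comm, Category.assoc, H.comm, ← Category.assoc,
    helixMap_comp H.distinguished, zero_comp]

/-- `Hom(r n, V)` is bijective for `V ≥ a`, so exactness passes from the helix to its truncation. -/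
lemma desc (H : t.IsTruncatedHelix f g h a e r) (n : ℕ) {V : 𝒯} (hV : t.IsGE V a)
    (u : E (n + 1) ⟶ V) (hu : e n ≫ u = 0) : ∃ v : E (n + 2) ⟶ V, e (n + 1) ≫ v = u := by
  obtain ⟨v, hv⟩ := helix_yoneda_exact H.distinguished n (r (n + 1) ≫ u) (by
    rw [← Category.assoc, ← H.comm, Category.assoc, hu, comp_zero])
  obtain ⟨v', rfl⟩ := (H.isTruncation (n + 2)).desc hV v
  refine ⟨v', sub_eq_zero.1 ((H.isTruncation (n + 1)).hom_ext hV ?_)⟩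
  rw [Preadditive.comp_sub, ← Category.assoc, H.comm, Category.assoc, hv, sub_self]

lemma eq_zero_of_isLE (H : t.IsTruncatedHelix f g h a e r) (n : ℕ)
    (hn : t.IsLE (helixObj (Triangle.mk f g h) n) (a - 1)) : IsZero (E n) := by
  rw [IsZero.iff_id_eq_zero]
  have := H.isGE n
  exact (H.isTruncation n).hom_ext (H.isGE n) (t.zero _ (a - 1) a)

/-- The fibre of `r n` is `≤ a - 1`, so heredity makes `Hom(A, r n)` bijective for bounded `A ≥ a +
1`. -/
lemma lift_of_isGE (H : t.IsTruncatedHelix f g h a e r) (ht : t.IsHereditary)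
    (hX : t.IsGE X a) (hY : t.IsGE Y a)
    (n : ℕ) {A : 𝒯} (hA : t.IsGE A (a + 1)) (hA' : t.IsLE A b) (y : A ⟶ E (n + 1))
    (hy : y ≫ e (n + 1) = 0) : ∃ z, z ≫ e n = y := by
  obtain ⟨c, hc⟩ := exists_isGE_helixObj H.distinguished hX hY (n + 1)
  obtain ⟨c', hc'⟩ := exists_isGE_helixObj H.distinguished hX hY (n + 2)
  obtain ⟨y, rfl⟩ := (H.isTruncation (n + 1)).lift ht hc (H.isGE _)
    (t.isGE_of_ge A a (a + 1)) hA' y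
  rw [Category.assoc, H.comm, ← Category.assoc] at hy
  obtain ⟨z, rfl⟩ := helix_coyoneda_exact H.distinguished n y
    ((H.isTruncation (n + 2)).eq_zero ht hc' (H.isGE _) hA hA' _ hy)
  exact ⟨z ≫ r n, by rw [Category.assoc, Category.assoc, H.comm]⟩

variable {m : ℕ}

/-- Position `Y⟦k⟧`: a lift `y` to the helix reaches `Z⟦k⟧` through some `G` in `[a - 1 - k, a -
1]`. Injectivity of `f⟦k + 1⟧` there lifts `G ⟶ Z⟦k⟧` to `s : G ⟶ Y⟦k⟧`. Then `y - p ≫ s` comes from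
`X⟦k⟧`, and `p ≫ s` is invisible in the truncation. -/
lemma lift₁ (H : t.IsTruncatedHelix f g h a e r) (ht : t.IsHereditary)
    (hX : t.IsGE X a) (hY : t.IsGE Y a) (hf : t.IsMonoOn a (a + m) f)
    (k : ℕ) (hk : k ≤ m) {A : 𝒯} (hA : t.IsGE A a) (hA' : t.IsLE A b)
    (y : A ⟶ E (3 * k + 1)) (hy : y ≫ e (3 * k + 1) = 0) : ∃ z, z ≫ e (3 * k) = y := by
  have hW₁ := (isGE_helixObj H.distinguished hX hY k).2.1
  have hW₂ := (isGE_helixObj H.distinguished hX hY k).2.2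
  obtain ⟨y, rfl⟩ := (H.isTruncation (3 * k + 1)).lift ht hW₁ (H.isGE _) hA hA' y
  rw [Category.assoc, H.comm, ← Category.assoc] at hy
  obtain ⟨G, p, q, hG, hG', hpq⟩ := (H.isTruncation (3 * k + 2)).factor (by lia) hW₂ (H.isGE _) _ hy
  obtain ⟨s, rfl⟩ := helix_coyoneda_exact H.distinguished (3 * k + 1) q
    (hf.helixMap (g := g) (h := h) (k + 1) _ (t.isGE_of_ge G _ (a - 1 - k) (by push_cast; lia))
      (t.isLE_of_le G (a - 1) _ (by push_cast; lia))
      (by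
        erw [Category.assoc, helixMap_comp H.distinguished (3 * k + 2), comp_zero]))
  obtain ⟨z, hz⟩ := helix_coyoneda_exact H.distinguished (3 * k) (y - p ≫ s) (by
    rw [Preadditive.sub_comp, Category.assoc, hpq, sub_self])
  have hs : s ≫ r (3 * k + 1) = 0 := by
    have := H.isGE (3 * k + 1)
    exact t.zero _ (a - 1) a
  refine ⟨z ≫ r (3 * k), ?_⟩
  rw [Category.assoc, H.comm, ← Category.assoc, ← hz, Preadditive.sub_comp, Category.assoc, hs,
    comp_zero, sub_zero]

/-- Position `Z⟦k⟧`: the composite `A ⟶ Z⟦k⟧ ⟶ X⟦k + 1⟧` is killed by `f⟦k + 1⟧`, hence zero, since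
`k < m` keeps degree `a` in the range of injectivity. -/
lemma lift₂ (H : t.IsTruncatedHelix f g h a e r) (ht : t.IsHereditary)
    (hX : t.IsGE X a) (hY : t.IsGE Y a) (hf : t.IsMonoOn a (a + m) f)
    (k : ℕ) (hk : k < m) {A : 𝒯} (hA : t.IsGE A a) (hA' : t.IsLE A a)
    (y : A ⟶ E (3 * k + 2)) : ∃ z, z ≫ e (3 * k + 1) = y := by
  have hW₂ := (isGE_helixObj H.distinguished hX hY k).2.2
  obtain ⟨y, rfl⟩ := (H.isTruncation (3 * k + 2)).lift ht hW₂ (H.isGE _) hA hA' y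
  obtain ⟨z, rfl⟩ := helix_coyoneda_exact H.distinguished (3 * k + 1) y
    (hf.helixMap (g := g) (h := h) (k + 1) _ (t.isGE_of_ge A _ a (by push_cast; lia))
      (t.isLE_of_le A a _ (by push_cast; lia))
      (by
        erw [Category.assoc, helixMap_comp H.distinguished (3 * k + 2), comp_zero]))
  exact ⟨z ≫ r (3 * k + 1), by rw [Category.assoc, Category.assoc, H.comm]⟩

/-- Position `X⟦k + 1⟧`: the image in `Y⟦k + 1⟧` factors through `p : A ⟶ G` with `G ≤ a - 1`. The
cone of `p` lies in `[a - k - 2, a - 1]`, where `f⟦k + 2⟧` is injective, so `y` itself factors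
through `G` and dies in the truncation. -/
lemma eq_zero₃ (H : t.IsTruncatedHelix f g h a e r) (ht : t.IsHereditary)
    (hX : t.IsGE X a) (hY : t.IsGE Y a) (hf : t.IsMonoOn a (a + m) f)
    (k : ℕ) (hk : k < m) {A : 𝒯} (hA : t.IsGE A a) (hA' : t.IsLE A a)
    (y : A ⟶ E (3 * k + 3)) (hy : y ≫ e (3 * k + 3) = 0) : y = 0 := by
  have hW₀ : t.IsGE (helixObj (Triangle.mk f g h) (3 * k + 3)) (a - (k + 1 : ℕ)) :=
    (isGE_helixObj H.distinguished hX hY (k + 1)).1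
  have hW₁ : t.IsGE (helixObj (Triangle.mk f g h) (3 * k + 4)) (a - (k + 1 : ℕ)) :=
    (isGE_helixObj H.distinguished hX hY (k + 1)).2.1
  obtain ⟨y, rfl⟩ := (H.isTruncation (3 * k + 3)).lift ht hW₀ (H.isGE _) hA hA' y
  rw [Category.assoc, H.comm, ← Category.assoc] at hy
  obtain ⟨G, p, q, hG, hG', hpq⟩ := (H.isTruncation (3 * k + 4)).factor (by lia) hW₁ (H.isGE _) _ hy
  obtain ⟨N, i, δ, hD⟩ := distinguished_cocone_triangle p
  have hN : t.IsLE N (a - 1) := isLE_obj₃ hD _ (by simpa using hA') hG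
  have hN' : t.IsGE N (a - (k + 2 : ℕ)) := isGE_obj₃ hD _
    (t.isGE_of_ge A _ a (by push_cast; lia)) (t.isGE_of_ge G _ (a - (k + 1 : ℕ)) (by push_cast; lia))
  obtain ⟨x, rfl⟩ := helix_factor_of_cone H.distinguished (3 * k + 3) hD y q hpq
    (fun c hc ↦ hf.helixMap (g := g) (h := h) (k + 2) c hN'
      (t.isLE_of_le N (a - 1) _ (by push_cast; lia)) hc)
  have hx : x ≫ r (3 * k + 3) = 0 := by
    have := H.isGE (3 * k + 3)
    exact t.zero _ (a - 1) a
  rw [Category.assoc, hx, comp_zero]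

/-- If the first morphism is injective on morphisms from the objects between `a` and `a + m`, a
truncated helix is exact on such morphisms. -/
lemma lift (H : t.IsTruncatedHelix f g h a e r) (ht : t.IsHereditary)
    (hX : t.IsGE X a) (hY : t.IsGE Y a) (hf : t.IsMonoOn a (a + m) f)
    (n : ℕ) (hn : n ≤ 3 * m) {A : 𝒯} (hA : t.IsGE A a) (hA' : t.IsLE A b)
    (y : A ⟶ E (n + 1)) (hy : y ≫ e (n + 1) = 0) : ∃ z, z ≫ e n = y := by
  refine exists_lift_of_truncation ht hA hA' (e n) (e (n + 1)) ?_
    (fun B y hB hB' hy ↦ H.lift_of_isGE ht hX hY n hB hB' y hy) y hy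
  intro B y hB hB' hy
  obtain ⟨k, rfl | rfl | rfl⟩ : ∃ k, n = 3 * k ∨ n = 3 * k + 1 ∨ n = 3 * k + 2 :=
    ⟨n / 3, by lia⟩
  · exact H.lift₁ ht hX hY hf k (by lia) hB hB' y hy
  · exact H.lift₂ ht hX hY hf k (by lia) hB hB' y
  · exact ⟨0, by rw [zero_comp, H.eq_zero₃ ht hX hY hf k (by lia) hB hB' y hy]⟩

end IsTruncatedHelix

end

end TStructure

end CategoryTheory.Triangulated

/-! ### Comparing sequences of weak cokernels -/

section

variable {M : Type*} [Category* M]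

/-- The sequence of objects obtained by prepending `X` and `Y` to a sequence. -/
def prependObj (X Y : M) (E : ℕ → M) : ℕ → M
  | 0 => X
  | 1 => Y
  | n + 2 => E n

/-- The first `n` morphisms of an infinite sequence of morphisms. -/
noncomputable def composableArrowsOfSequence {E : ℕ → M} (e : ∀ n, E n ⟶ E (n + 1)) (n : ℕ) :
    ComposableArrows M n :=
  ComposableArrows.mkOfObjOfMapSucc (fun i : Fin (n + 1) ↦ E i) (fun i ↦ e i)

lemma composableArrowsOfSequence_map' {E : ℕ → M} (e : ∀ n, E n ⟶ E (n + 1)) (n k : ℕ)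
    (hk : k < n) :
    (composableArrowsOfSequence e n).map' k (k + 1) = e k :=
  ComposableArrows.mkOfObjOfMapSucc_map_succ _ _ k hk

variable [Preadditive M]

lemma isDCokernelSeq_composableArrowsOfSequence {E : ℕ → M} (e : ∀ n, E n ⟶ E (n + 1))
    (comp : ∀ n, e n ≫ e (n + 1) = 0)
    (desc : ∀ (n : ℕ) (Z : M) (u : E (n + 1) ⟶ Z), e n ≫ u = 0 →
      ∃ v : E (n + 2) ⟶ Z, e (n + 1) ≫ v = u) (d : ℕ) (hd : IsZero (E (d + 2))) :
    IsDCokernelSeq (composableArrowsOfSequence e (d + 1)) where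
  injective Y := by
    rw [composableArrowsOfSequence_map' e (d + 1) d (by lia)]
    intro (u : E (d + 1) ⟶ Y) (u' : E (d + 1) ⟶ Y) (huu' : e d ≫ u = e d ≫ u')
    -- `e d` is epi because its weak cokernel `E (d + 2)` is zero.
    obtain ⟨v, hv⟩ := desc d Y (u - u') (by rw [Preadditive.comp_sub, huu', sub_self])
    rw [hd.eq_of_src v 0, comp_zero] at hv
    exact sub_eq_zero.1 hv.symm
  exact Y k hk := by
    rw [composableArrowsOfSequence_map' e (d + 1) k (by lia),
      composableArrowsOfSequence_map' e (d + 1) (k + 1) (by lia)]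
    intro (u : E (k + 1) ⟶ Y)
    refine ⟨fun hu ↦ desc k Y u hu, ?_⟩
    have key (v : E (k + 2) ⟶ Y) : e k ≫ e (k + 1) ≫ v = 0 := by
      rw [← Category.assoc, comp, zero_comp]
    rintro ⟨v, rfl⟩
    exact key v

namespace IsDCokernelSeq

variable {d : ℕ} {S : ComposableArrows M (d + 1)}

lemma comp (hS : IsDCokernelSeq S) (k : ℕ) (hk : k < d) :
    S.map' k (k + 1) ≫ S.map' (k + 1) (k + 2) = 0 :=
  (hS.exact _ k hk _).2 ⟨𝟙 _, Category.comp_id _⟩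

lemma desc (hS : IsDCokernelSeq S) (k : ℕ) (hk : k < d) {Y : M} (u : S.obj' (k + 1) ⟶ Y)
    (hu : S.map' k (k + 1) ≫ u = 0) : ∃ v : S.obj' (k + 2) ⟶ Y, S.map' (k + 1) (k + 2) ≫ v = u :=
  (hS.exact Y k hk u).1 hu

/-- Two sequences of weak cokernels of the same morphism are locally homotopy equivalent. -/
lemma exists_homotopy (hS : IsDCokernelSeq S) {E : ℕ → M}
    (e : ∀ n, prependObj (S.obj' 0) (S.obj' 1) E n ⟶ prependObj (S.obj' 0) (S.obj' 1) E (n + 1))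
    (e₀ : e 0 = S.map' 0 1) (comp : ∀ n, e n ≫ e (n + 1) = 0)
    (desc : ∀ (n : ℕ) (Z : M) (u : prependObj (S.obj' 0) (S.obj' 1) E (n + 1) ⟶ Z), e n ≫ u = 0 →
      ∃ v : prependObj (S.obj' 0) (S.obj' 1) E (n + 2) ⟶ Z, e (n + 1) ≫ v = u)
    (k : ℕ) (hk : k ≤ d + 1) (hk' : k + 1 ≤ d + 1) :
    ∃ (φ₀ : S.obj' k hk ⟶ prependObj (S.obj' 0) (S.obj' 1) E k)
      (φ₁ : S.obj' (k + 1) hk' ⟶ prependObj (S.obj' 0) (S.obj' 1) E (k + 1))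
      (ψ₀ : prependObj (S.obj' 0) (S.obj' 1) E k ⟶ S.obj' k hk)
      (ψ₁ : prependObj (S.obj' 0) (S.obj' 1) E (k + 1) ⟶ S.obj' (k + 1) hk')
      (h : S.obj' (k + 1) hk' ⟶ S.obj' k hk),
      S.map' k (k + 1) k.le_succ hk' ≫ φ₁ = φ₀ ≫ e k ∧
      e k ≫ ψ₁ = ψ₀ ≫ S.map' k (k + 1) k.le_succ hk' ∧
      S.map' k (k + 1) k.le_succ hk' ≫
        (𝟙 _ - φ₁ ≫ ψ₁ - h ≫ S.map' k (k + 1) k.le_succ hk') = 0 := by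
  induction k with
  | zero =>
    refine ⟨𝟙 (S.obj' 0), 𝟙 (S.obj' 1), 𝟙 (S.obj' 0), 𝟙 (S.obj' 1), 0, ?_, ?_, ?_⟩
    · rw [e₀]
      exact (Category.comp_id _).trans (Category.id_comp _).symm
    · rw [e₀]
      exact (Category.comp_id _).trans (Category.id_comp _).symm
    · rw [zero_comp, sub_zero]
      erw [Category.comp_id, sub_self, comp_zero]
  | succ k ih =>
    obtain ⟨φ₀, φ₁, ψ₀, ψ₁, h, hφ, hψ, hh⟩ := ih (by lia) (by lia)
    obtain ⟨φ₂, hφ₂⟩ := hS.desc k (by lia) (φ₁ ≫ e (k + 1)) (by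
      rw [← Category.assoc, hφ, Category.assoc, comp, comp_zero])
    obtain ⟨ψ₂, hψ₂⟩ := desc k _ (ψ₁ ≫ S.map' (k + 1) (k + 2)) (by
      rw [← Category.assoc, hψ, Category.assoc, hS.comp k (by lia), comp_zero])
    -- The homotopy defect in one degree factors through the next map, and the factor is the next
    -- homotopy. Two adjacent degrees suffice for the induction.
    obtain ⟨h₂, hh₂⟩ := hS.desc k (by lia) _ hh
    refine ⟨φ₁, φ₂, ψ₁, ψ₂, h₂, hφ₂, hψ₂, ?_⟩
    rw [Preadditive.comp_sub, Preadditive.comp_sub, Category.comp_id, ← Category.assoc, hφ₂,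
      Category.assoc, hψ₂, ← Category.assoc, ← Category.assoc, hh₂, Preadditive.sub_comp,
      Preadditive.sub_comp, Category.id_comp, Category.assoc, Category.assoc,
      hS.comp k (by lia), comp_zero, sub_zero, sub_self]

/-- A `d`-cokernel of a monomorphism is `d`-exact if a sequence of weak cokernels of this
monomorphism is exact on the left. -/
lemma isDKernelSeq_of_sequence (hS : IsDCokernelSeq S) (hmono : Mono (S.map' 0 1)) {E : ℕ → M}
    (e : ∀ n, prependObj (S.obj' 0) (S.obj' 1) E n ⟶ prependObj (S.obj' 0) (S.obj' 1) E (n + 1))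
    (e₀ : e 0 = S.map' 0 1) (comp : ∀ n, e n ≫ e (n + 1) = 0)
    (desc : ∀ (n : ℕ) (Z : M) (u : prependObj (S.obj' 0) (S.obj' 1) E (n + 1) ⟶ Z), e n ≫ u = 0 →
      ∃ v : prependObj (S.obj' 0) (S.obj' 1) E (n + 2) ⟶ Z, e (n + 1) ≫ v = u)
    (lift : ∀ n < d, ∀ (A : M) (y : A ⟶ prependObj (S.obj' 0) (S.obj' 1) E (n + 1)),
      y ≫ e (n + 1) = 0 → ∃ z : A ⟶ prependObj (S.obj' 0) (S.obj' 1) E n, z ≫ e n = y) :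
    IsDKernelSeq S where
  injective Y u u' h := by
    rwa [← cancel_mono (S.map' 0 1 _ _)]
  exact Y k hk := by
    intro y
    refine ⟨fun (hy : y ≫ S.map' (k + 1) (k + 2) = 0) ↦ ?_, ?_⟩
    · obtain ⟨φ₀, φ₁, ψ₀, ψ₁, h, hφ, hψ, hh⟩ := hS.exists_homotopy e e₀ comp desc k (by lia) (by lia)
      obtain ⟨φ₂, hφ₂⟩ := hS.desc k (by lia) (φ₁ ≫ e (k + 1)) (by
        rw [← Category.assoc, hφ, Category.assoc, comp, comp_zero])
      obtain ⟨h₂, hh₂⟩ := hS.desc k (by lia) _ hh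
      obtain ⟨z, hz⟩ := lift k hk Y (y ≫ φ₁) (by
        rw [Category.assoc, ← hφ₂, ← Category.assoc, hy, zero_comp])
      -- The lift found in the comparison sequence is carried back by `ψ₀` and corrected by the
      -- homotopy.
      refine ⟨z ≫ ψ₀ + y ≫ h, ?_⟩
      have h0 : y ≫ (𝟙 _ - φ₁ ≫ ψ₁ - h ≫ S.map' k (k + 1)) = 0 := by
        rw [← hh₂, ← Category.assoc, hy, zero_comp]
      rw [Preadditive.comp_sub, Preadditive.comp_sub, Category.comp_id, ← Category.assoc, ← hz,
        Category.assoc, hψ, sub_sub, sub_eq_zero] at h0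
      change (z ≫ ψ₀ + y ≫ h) ≫ S.map' k (k + 1) = y
      rw [Preadditive.add_comp, Category.assoc, Category.assoc]
      exact h0.symm
    · rintro ⟨z, rfl⟩
      change (z ≫ S.map' k (k + 1)) ≫ S.map' (k + 1) (k + 2) = 0
      rw [Category.assoc, hS.comp k hk, comp_zero]

end IsDCokernelSeq

end

/-! ### Cokernel sequences in the window -/

namespace CategoryTheory.Triangulated.TStructure

open Pretriangulated

variable {𝒯 : Type*} [Category* 𝒯] [Preadditive 𝒯] [HasZeroObject 𝒯] [HasShift 𝒯 ℤ]
  [∀ n : ℤ, (shiftFunctor 𝒯 n).Additive] [Pretriangulated 𝒯] {t : TStructure 𝒯}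
  {M : Type*} [Category* M] [Preadditive M] {ι : M ⥤ 𝒯} [ι.Full] [ι.Faithful] [ι.Additive]
  {a : ℤ} {m : ℕ}

variable (t) in
/-- The morphisms of a full subcategory `M` which consists of the objects between `a` and `a + m`
have a sequence of weak cokernels, obtained by truncating the helix of a triangle. -/
lemma exists_weakCokernel_sequence
    (hι : ∀ A, ι.essImage A ↔ t.IsGE A a ∧ t.IsLE A (a + m)) {X Y : M} (f : X ⟶ Y) :
    ∃ (E : ℕ → M) (e : ∀ n, prependObj X Y E n ⟶ prependObj X Y E (n + 1)),
      e 0 = f ∧ (∀ n, e n ≫ e (n + 1) = 0) ∧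
      (∀ (n : ℕ) (Z : M) (u : prependObj X Y E (n + 1) ⟶ Z), e n ≫ u = 0 →
        ∃ v : prependObj X Y E (n + 2) ⟶ Z, e (n + 1) ≫ v = u) ∧
      IsZero (prependObj X Y E (3 * m + 3)) ∧
      (t.IsHereditary → Mono f →
        ∀ n < 3 * m + 1, ∀ (A : M) (y : A ⟶ prependObj X Y E (n + 1)),
          y ≫ e (n + 1) = 0 → ∃ z : A ⟶ prependObj X Y E n, z ≫ e n = y) := by
  have hX (A : M) := (hι _).1 (ι.obj_mem_essImage A)
  obtain ⟨Z, g, h, hT⟩ := distinguished_cocone_triangle (ι.map f)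
  let W (n : ℕ) := helixObj (Triangle.mk (ι.map f) g h) n
  have hE (n : ℕ) : ∃ (V : M) (r : W n ⟶ ι.obj V), t.IsTruncation a r := by
    have : t.IsLE (W n) (a + m) := isLE_helixObj_of_le hT (hX X).2 (hX Y).2 n
    have : t.IsLE ((t.truncLT a).obj (W n)) (a + m + 1) := t.isLE_truncLT_obj _ _ _
    have : t.IsLE ((t.truncGE a).obj (W n)) (a + m) :=
      isLE_obj₃ (t.triangleLTGE_distinguished a (W n)) _ ‹_› ‹_›
    obtain ⟨V, ⟨i⟩⟩ := (hι ((t.truncGE a).obj (W n))).2 ⟨inferInstance, this⟩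
    exact ⟨V, _, (t.isTruncation_truncGEπ a (W n)).comp_iso i.symm⟩
  choose E' r' hr' using hE
  let E (n : ℕ) := E' (n + 2)
  -- Identities in positions `0` and `1` make `e 0` equal to `f`, not merely isomorphic to it.
  let r : ∀ n, W n ⟶ ι.obj (prependObj X Y E n)
    | 0 => 𝟙 (ι.obj X)
    | 1 => 𝟙 (ι.obj Y)
    | n + 2 => r' (n + 2)
  have hr (n : ℕ) : t.IsTruncation a (r n) :=
    match n with
    | 0 => t.isTruncation_id a (ι.obj X)
    | 1 => t.isTruncation_id a (ι.obj Y)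
    | n + 2 => hr' (n + 2)
  have he (n : ℕ) : ∃ e : prependObj X Y E n ⟶ prependObj X Y E (n + 1),
      r n ≫ ι.map e = helixMap (Triangle.mk (ι.map f) g h) n ≫ r (n + 1) := by
    obtain ⟨e, he⟩ := (hr n).desc (hX _).1
      (helixMap (Triangle.mk (ι.map f) g h) n ≫ r (n + 1))
    obtain ⟨e, rfl⟩ := ι.map_surjective e
    exact ⟨e, he⟩
  choose e he using he
  have H : t.IsTruncatedHelix (ι.map f) g h a (fun n ↦ ι.map (e n)) r :=
    { distinguished := hT
      isTruncation := hr
      isGE n := (hX _).1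
      comm := he }
  refine ⟨E, e, ?_, fun n ↦ ι.map_injective ?_, fun n V u hu ↦ ?_, ?_, fun ht hf n hn A y hy ↦ ?_⟩
  · refine ι.map_injective ?_
    have h0 : 𝟙 (ι.obj X) ≫ ι.map (e 0) = ι.map f ≫ 𝟙 (ι.obj Y) := he 0
    rw [Category.comp_id] at h0
    exact (Category.id_comp _).symm.trans h0
  · rw [ι.map_comp, H.comp n, ι.map_zero]
  · obtain ⟨v, hv⟩ := H.desc n (hX V).1 (ι.map u) (by
      rw [← ι.map_comp, hu, ι.map_zero])
    obtain ⟨v, rfl⟩ := ι.map_surjective v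
    exact ⟨v, ι.map_injective (by rw [ι.map_comp, hv])⟩
  -- Position `3 * m + 3` is `X⟦m + 1⟧`, which is `≤ a - 1`.
  · have := H.eq_zero_of_isLE (3 * m + 3) (by
      have h1 := (isLE_helixObj hT (hX X).2 (hX Y).2 (m + 1)).1
      have h2 : (a + m - (m + 1 : ℕ) : ℤ) = a - 1 := by push_cast; ring
      rw [h2] at h1
      exact h1)
    rw [IsZero.iff_id_eq_zero] at this ⊢
    exact ι.map_injective (by rw [ι.map_id, this, ι.map_zero])
  · have hf' : t.IsMonoOn a (a + m) (ι.map f) := by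
      intro V u hV hV' hu
      obtain ⟨V', ⟨i⟩⟩ := (hι V).2 ⟨hV, hV'⟩
      obtain ⟨u', hu'⟩ := ι.map_surjective (i.hom ≫ u)
      have : u' = 0 := by
        rw [← cancel_mono f, zero_comp]
        exact ι.map_injective (by rw [ι.map_comp, hu', Category.assoc, hu, comp_zero, ι.map_zero])
      rw [← cancel_epi i.hom, ← hu', this, ι.map_zero, comp_zero]
    obtain ⟨z, hz⟩ := H.lift ht (hX X).1 (hX Y).1 hf' n (by lia) (hX A).1 (hX A).2
      (ι.map y) (by rw [← ι.map_comp, hy, ι.map_zero])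
    obtain ⟨z, rfl⟩ := ι.map_surjective z
    exact ⟨z, ι.map_injective (by rw [ι.map_comp, hz])⟩

lemma exists_isDCokernelSeq
    (hι : ∀ A, ι.essImage A ↔ t.IsGE A a ∧ t.IsLE A (a + m)) {X Y : M} (f : X ⟶ Y) :
    ∃ S : ComposableArrows M (3 * m + 1 + 1),
      Arrow.mk (S.map' 0 1) = Arrow.mk f ∧ IsDCokernelSeq S := by
  obtain ⟨E, e, he, comp, desc, hE, -⟩ := t.exists_weakCokernel_sequence hι f
  refine ⟨composableArrowsOfSequence e _, ?_,
    isDCokernelSeq_composableArrowsOfSequence e comp desc _ hE⟩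
  rw [← he]
  exact congrArg Arrow.mk (composableArrowsOfSequence_map' e _ 0 (by lia))

lemma isDKernelSeq_of_mono (ht : t.IsHereditary)
    (hι : ∀ A, ι.essImage A ↔ t.IsGE A a ∧ t.IsLE A (a + m))
    (S : ComposableArrows M (3 * m + 1 + 1)) (hf : Mono (S.map' 0 1)) (hS : IsDCokernelSeq S) :
    IsDKernelSeq S := by
  obtain ⟨E, e, he, comp, desc, -, lift⟩ := t.exists_weakCokernel_sequence hι (S.map' 0 1)
  exact hS.isDKernelSeq_of_sequence hf e he comp desc (lift ht hf)

end CategoryTheory.Triangulated.TStructure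

/-! ### Reversing sequences in the opposite category -/

section

open Opposite

namespace CategoryTheory.ComposableArrows

variable {M : Type*} [Category* M] {n : ℕ}

/-- The sequence of morphisms in the opposite category, in the reversed order. -/
def opRev (S : ComposableArrows M n) : ComposableArrows Mᵒᵖ n where
  obj i := op (S.obj i.rev)
  map f := (S.map (homOfLE (Fin.rev_le_rev.2 (leOfHom f)))).op
  map_id _ := congrArg Quiver.Hom.op (S.map_id _)
  map_comp _ _ := by
    rw [← op_comp, ← S.map_comp]
    rfl

/-- The reversed sequence of a sequence of morphisms in the opposite category. -/
def unopRev (S : ComposableArrows Mᵒᵖ n) : ComposableArrows M n where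
  obj i := (S.obj i.rev).unop
  map f := (S.map (homOfLE (Fin.rev_le_rev.2 (leOfHom f)))).unop
  map_id _ := congrArg Quiver.Hom.unop (S.map_id _)
  map_comp _ _ := by
    rw [← unop_comp, ← S.map_comp]
    rfl

lemma mk_map_eq_of_val_eq (S : ComposableArrows M n) {i j i' j' : Fin (n + 1)} (f : i ⟶ j)
    (f' : i' ⟶ j') (hi : i.val = i'.val) (hj : j.val = j'.val) :
    Arrow.mk (S.map f) = Arrow.mk (S.map f') := by
  obtain rfl := Fin.ext hi
  obtain rfl := Fin.ext hj
  rw [Subsingleton.elim f f']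

lemma epi_map_of_val_eq (S : ComposableArrows M n) {i j i' j' : Fin (n + 1)} (f : i ⟶ j)
    (f' : i' ⟶ j') (hi : i.val = i'.val) (hj : j.val = j'.val) (hf : Epi (S.map f)) :
    Epi (S.map f') := by
  obtain rfl := Fin.ext hi
  obtain rfl := Fin.ext hj
  rwa [Subsingleton.elim f' f]

lemma map_eq_of_eq (S : ComposableArrows M n) {i j i' j' : Fin (n + 1)} (f : i ⟶ j)
    (f' : i' ⟶ j') (hi : i = i') (hj : j = j') :
    S.map f = eqToHom (by rw [hi]) ≫ S.map f' ≫ eqToHom (by rw [hj]) := by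
  subst hi hj
  rw [Subsingleton.elim f f', eqToHom_refl, eqToHom_refl, Category.comp_id, Category.id_comp]

lemma unopRev_opRev (S : ComposableArrows M n) : S.opRev.unopRev = S :=
  CategoryTheory.Functor.ext (fun i ↦ congrArg S.obj i.rev_rev)
    (fun i j f ↦ S.map_eq_of_eq _ f i.rev_rev j.rev_rev)

end CategoryTheory.ComposableArrows

variable {M : Type*} [Category* M] [Preadditive M] {d : ℕ}

namespace IsDCokernelSeq

/-- Free indices with prescribed values accommodate the `Fin.rev` terms of reversed sequences. -/
lemma injective' {S : ComposableArrows M (d + 1)} (hS : IsDCokernelSeq S) {i j : Fin (d + 1 + 1)}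
    (f : i ⟶ j) (hi : i.val = d) (hj : j.val = d + 1) (Y : M) :
    Function.Injective (fun h : S.obj j ⟶ Y ↦ S.map f ≫ h) := by
  obtain ⟨i, hi'⟩ := i
  obtain ⟨j, hj'⟩ := j
  dsimp only at hi hj
  subst hi hj
  exact hS.injective Y

lemma exact' {S : ComposableArrows M (d + 1)} (hS : IsDCokernelSeq S) {i j k : Fin (d + 1 + 1)}
    (f : i ⟶ j) (g : j ⟶ k) (hj : j.val = i.val + 1) (hk : k.val = i.val + 2) (Y : M) :
    Function.Exact (fun h : S.obj k ⟶ Y ↦ S.map g ≫ h) (fun h : S.obj j ⟶ Y ↦ S.map f ≫ h) := by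
  obtain ⟨i, hi'⟩ := i
  obtain ⟨j, hj'⟩ := j
  obtain ⟨k, hk'⟩ := k
  dsimp only at hj hk
  subst hj hk
  exact hS.exact Y i (by lia)

end IsDCokernelSeq

namespace IsDKernelSeq

lemma injective' {S : ComposableArrows M (d + 1)} (hS : IsDKernelSeq S) {i j : Fin (d + 1 + 1)}
    (f : i ⟶ j) (hi : i.val = 0) (hj : j.val = 1) (Y : M) :
    Function.Injective (fun h : Y ⟶ S.obj i ↦ h ≫ S.map f) := by
  obtain ⟨i, hi'⟩ := i
  obtain ⟨j, hj'⟩ := j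
  dsimp only at hi hj
  subst hi hj
  exact hS.injective Y

lemma exact' {S : ComposableArrows M (d + 1)} (hS : IsDKernelSeq S) {i j k : Fin (d + 1 + 1)}
    (f : i ⟶ j) (g : j ⟶ k) (hj : j.val = i.val + 1) (hk : k.val = i.val + 2) (Y : M) :
    Function.Exact (fun h : Y ⟶ S.obj i ↦ h ≫ S.map f) (fun h : Y ⟶ S.obj j ↦ h ≫ S.map g) := by
  obtain ⟨i, hi'⟩ := i
  obtain ⟨j, hj'⟩ := j
  obtain ⟨k, hk'⟩ := k
  dsimp only at hj hk
  subst hj hk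
  exact hS.exact Y i (by lia)

end IsDKernelSeq

lemma exact_precomp_op {X Y Z : M} {f : X ⟶ Y} {g : Y ⟶ Z} {A : Mᵒᵖ}
    (H : Function.Exact (fun h : A.unop ⟶ X ↦ h ≫ f) (fun h : A.unop ⟶ Y ↦ h ≫ g)) :
    Function.Exact (fun h : op X ⟶ A ↦ f.op ≫ h) (fun h : op Y ⟶ A ↦ g.op ≫ h) := by
  intro y
  refine ⟨fun hy ↦ ?_, ?_⟩
  · obtain ⟨z, hz⟩ := (H y.unop).1 (congrArg Quiver.Hom.unop hy)
    exact ⟨z.op, congrArg Quiver.Hom.op hz⟩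
  · rintro ⟨z, rfl⟩
    exact congrArg Quiver.Hom.op ((H (z.unop ≫ f)).2 ⟨z.unop, rfl⟩)

lemma exact_postcomp_unop {X Y Z : Mᵒᵖ} {f : X ⟶ Y} {g : Y ⟶ Z} {A : M}
    (H : Function.Exact (fun h : Z ⟶ op A ↦ g ≫ h) (fun h : Y ⟶ op A ↦ f ≫ h)) :
    Function.Exact (fun h : A ⟶ Z.unop ↦ h ≫ g.unop) (fun h : A ⟶ Y.unop ↦ h ≫ f.unop) := by
  intro y
  refine ⟨fun hy ↦ ?_, ?_⟩
  · obtain ⟨z, hz⟩ := (H y.op).1 (congrArg Quiver.Hom.op hy)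
    exact ⟨z.unop, congrArg Quiver.Hom.unop hz⟩
  · rintro ⟨z, rfl⟩
    exact congrArg Quiver.Hom.unop ((H (g ≫ z.op)).2 ⟨z.op, rfl⟩)

lemma exact_precomp_unop {X Y Z : Mᵒᵖ} {f : X ⟶ Y} {g : Y ⟶ Z} {A : M}
    (H : Function.Exact (fun h : op A ⟶ X ↦ h ≫ f) (fun h : op A ⟶ Y ↦ h ≫ g)) :
    Function.Exact (fun h : X.unop ⟶ A ↦ f.unop ≫ h) (fun h : Y.unop ⟶ A ↦ g.unop ≫ h) := by
  intro y
  refine ⟨fun hy ↦ ?_, ?_⟩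
  · obtain ⟨z, hz⟩ := (H y.op).1 (congrArg Quiver.Hom.op hy)
    exact ⟨z.unop, congrArg Quiver.Hom.unop hz⟩
  · rintro ⟨z, rfl⟩
    exact congrArg Quiver.Hom.unop ((H (z.op ≫ f)).2 ⟨z.op, rfl⟩)

lemma IsDKernelSeq.opRev {S : ComposableArrows M (d + 1)} (hS : IsDKernelSeq S) :
    IsDCokernelSeq S.opRev where
  injective Y u u' h := by
    refine Quiver.Hom.unop_inj (hS.injective' (i := Fin.rev ⟨d + 1, by lia⟩)
      (j := Fin.rev ⟨d, by lia⟩) (homOfLE (Fin.rev_le_rev.2 (by simp))) ?_ ?_ Y.unop ?_)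
    · simp [Fin.val_rev]
    · simp [Fin.val_rev]
    · exact congrArg Quiver.Hom.unop h
  exact Y k hk := by
    refine exact_precomp_op (hS.exact' (i := Fin.rev ⟨k + 2, by lia⟩)
      (j := Fin.rev ⟨k + 1, by lia⟩) (k := Fin.rev ⟨k, by lia⟩)
      (homOfLE (Fin.rev_le_rev.2 (by simp))) (homOfLE (Fin.rev_le_rev.2 (by simp))) ?_ ?_ Y.unop)
    · simp only [Fin.val_rev]; lia
    · simp only [Fin.val_rev]; lia

lemma IsDCokernelSeq.unopRev {S : ComposableArrows Mᵒᵖ (d + 1)} (hS : IsDCokernelSeq S) :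
    IsDKernelSeq S.unopRev where
  injective Y u u' h := by
    refine Quiver.Hom.op_inj (hS.injective' (i := Fin.rev ⟨1, by lia⟩)
      (j := Fin.rev ⟨0, by lia⟩) (homOfLE (Fin.rev_le_rev.2 (by simp))) ?_ ?_ (op Y) ?_)
    · simp only [Fin.val_rev]; lia
    · simp only [Fin.val_rev]; lia
    · exact congrArg Quiver.Hom.op h
  exact Y k hk := by
    refine exact_postcomp_unop (hS.exact' (i := Fin.rev ⟨k + 2, by lia⟩)
      (j := Fin.rev ⟨k + 1, by lia⟩) (k := Fin.rev ⟨k, by lia⟩)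
      (homOfLE (Fin.rev_le_rev.2 (by simp))) (homOfLE (Fin.rev_le_rev.2 (by simp))) ?_ ?_ (op Y))
    · simp only [Fin.val_rev]; lia
    · simp only [Fin.val_rev]; lia

lemma IsDKernelSeq.unopRev {S : ComposableArrows Mᵒᵖ (d + 1)} (hS : IsDKernelSeq S) :
    IsDCokernelSeq S.unopRev where
  injective Y u u' h := by
    refine Quiver.Hom.op_inj (hS.injective' (i := Fin.rev ⟨d + 1, by lia⟩)
      (j := Fin.rev ⟨d, by lia⟩) (homOfLE (Fin.rev_le_rev.2 (by simp))) ?_ ?_ (op Y) ?_)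
    · simp [Fin.val_rev]
    · simp [Fin.val_rev]
    · exact congrArg Quiver.Hom.op h
  exact Y k hk := by
    refine exact_precomp_unop (hS.exact' (i := Fin.rev ⟨k + 2, by lia⟩)
      (j := Fin.rev ⟨k + 1, by lia⟩) (k := Fin.rev ⟨k, by lia⟩)
      (homOfLE (Fin.rev_le_rev.2 (by simp))) (homOfLE (Fin.rev_le_rev.2 (by simp))) ?_ ?_ (op Y))
    · simp only [Fin.val_rev]; lia
    · simp only [Fin.val_rev]; lia

end

/-! ### The opposite t-structure and kernel sequences -/

namespace CategoryTheory.Triangulated.TStructure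

open Pretriangulated Opposite CategoryTheory.Pretriangulated.Opposite

variable {𝒯 : Type*} [Category* 𝒯] [Preadditive 𝒯] [HasZeroObject 𝒯] [HasShift 𝒯 ℤ]
  [∀ n : ℤ, (shiftFunctor 𝒯 n).Additive] [Pretriangulated 𝒯]

/-- The opposite t-structure. -/
def opposite (t : TStructure 𝒯) : TStructure 𝒯ᵒᵖ where
  le n := (t.ge (-n)).op
  ge n := (t.le (-n)).op
  le_shift n a n' h X hX := t.ge_shift (-n) (-a) (-n') (by lia) X.unop hX
  ge_shift n a n' h X hX := t.le_shift (-n) (-a) (-n') (by lia) X.unop hX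
  zero' X Y f hX hY := Quiver.Hom.unop_inj
    (t.zero_of_isLE_of_isGE f.unop (-1) 0 (by lia) ⟨hY⟩ ⟨hX⟩)
  le_zero_le X hX := t.ge_antitone (by lia) _ hX
  ge_one_le X hX := t.le_monotone (by lia) _ hX
  exists_triangle_zero_one A := by
    obtain ⟨X, Y, hX, hY, f, g, h, hT⟩ := t.exists_triangle A.unop (-1) 0 (by lia)
    exact ⟨op Y, op X, hY, hX, g.op, f.op, _, op_distinguished _ hT⟩

variable {t : TStructure 𝒯}

lemma isLE_opposite_iff {X : 𝒯ᵒᵖ} {n : ℤ} : t.opposite.IsLE X n ↔ t.IsGE X.unop (-n) :=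
  ⟨fun h ↦ ⟨h.le⟩, fun h ↦ ⟨h.ge⟩⟩

lemma isGE_opposite_iff {X : 𝒯ᵒᵖ} {n : ℤ} : t.opposite.IsGE X n ↔ t.IsLE X.unop (-n) :=
  ⟨fun h ↦ ⟨h.ge⟩, fun h ↦ ⟨h.le⟩⟩

lemma IsHereditary.opposite (ht : t.IsHereditary) : t.opposite.IsHereditary := by
  intro X Y f n a b hX hX' hY hY'
  rw [isGE_opposite_iff] at hX hY'
  rw [isLE_opposite_iff] at hX' hY
  refine Quiver.Hom.unop_inj (ht f.unop (-n) (-b) (-a) ?_ hY' ?_ hX')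
  · convert hY using 1
    lia
  · convert hX using 1
    lia

lemma _root_.CategoryTheory.Functor.essImage_op_iff {M N : Type*} [Category* M] [Category* N]
    {ι : M ⥤ N} (A : Nᵒᵖ) : ι.op.essImage A ↔ ι.essImage A.unop :=
  ⟨fun ⟨B, ⟨e⟩⟩ ↦ ⟨B.unop, ⟨e.unop.symm⟩⟩, fun ⟨B, ⟨e⟩⟩ ↦ ⟨op B, ⟨e.symm.op⟩⟩⟩

/-- The reflected window `[-(a + m), -a]` again has width `m`, so the cokernel results apply to
`ι.op`. -/
lemma essImage_op_iff_isGE_and_isLE {M : Type*} [Category* M] {ι : M ⥤ 𝒯} {a : ℤ} {m : ℕ}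
    (hι : ∀ A, ι.essImage A ↔ t.IsGE A a ∧ t.IsLE A (a + m)) (A : 𝒯ᵒᵖ) :
    ι.op.essImage A ↔ t.opposite.IsGE A (-(a + m)) ∧ t.opposite.IsLE A (-(a + m) + m) := by
  rw [Functor.essImage_op_iff, hι, isGE_opposite_iff, isLE_opposite_iff, and_comm, neg_neg]
  have : -(-(a + m) + m) = a := by ring
  rw [this]

variable {M : Type*} [Category* M] [Preadditive M] {ι : M ⥤ 𝒯} [ι.Full] [ι.Faithful] [ι.Additive]
  {a : ℤ} {m : ℕ}

lemma exists_isDKernelSeq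
    (hι : ∀ A, ι.essImage A ↔ t.IsGE A a ∧ t.IsLE A (a + m)) {X Y : M} (f : X ⟶ Y) :
    ∃ S : ComposableArrows M (3 * m + 1 + 1),
      Arrow.mk (S.map' (3 * m + 1) (3 * m + 1 + 1)) = Arrow.mk f ∧ IsDKernelSeq S := by
  obtain ⟨S, hf, hS⟩ := exists_isDCokernelSeq (essImage_op_iff_isGE_and_isLE hι) f.op
  refine ⟨S.unopRev, ?_, hS.unopRev⟩
  refine congrArg (fun A : Arrow Mᵒᵖ ↦ Arrow.mk A.hom.unop)
    ((S.mk_map_eq_of_val_eq (i := Fin.rev ⟨3 * m + 1 + 1, by lia⟩) (j := Fin.rev ⟨3 * m + 1, by lia⟩)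
      (homOfLE (Fin.rev_le_rev.2 (by simp))) _ ?_ ?_).trans hf)
  · simp [Fin.val_rev]
  · simp [Fin.val_rev]

lemma isDCokernelSeq_of_epi (ht : t.IsHereditary)
    (hι : ∀ A, ι.essImage A ↔ t.IsGE A a ∧ t.IsLE A (a + m))
    (S : ComposableArrows M (3 * m + 1 + 1)) (hf : Epi (S.map' (3 * m + 1) (3 * m + 1 + 1)))
    (hS : IsDKernelSeq S) : IsDCokernelSeq S := by
  have := isDKernelSeq_of_mono ht.opposite (essImage_op_iff_isGE_and_isLE hι) S.opRev
    (@CategoryTheory.op_mono_of_epi _ _ _ _ _ (S.epi_map_of_val_eq _ _ (by simp [Fin.val_rev])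
      (by simp) hf)) hS.opRev
  rw [← S.unopRev_opRev]
  exact this.unopRev

end CategoryTheory.Triangulated.TStructure

/-! ### Idempotents, dévissage and biproducts -/

namespace CategoryTheory

/-- All the idempotent endomorphisms of `X` split. -/
def SplitsIdempotents {M : Type*} [Category* M] (X : M) : Prop :=
  ∀ p : X ⟶ X, p ≫ p = p → ∃ (Y : M) (i : Y ⟶ X) (e : X ⟶ Y), i ≫ e = 𝟙 Y ∧ e ≫ i = p

lemma SplitsIdempotents.of_iso {M : Type*} [Category* M] {X Y : M} (hX : SplitsIdempotents X)
    (α : X ≅ Y) : SplitsIdempotents Y := by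
  intro p hp
  obtain ⟨Z, i, e, hie, hei⟩ := hX (α.hom ≫ p ≫ α.inv) (by simp [reassoc_of% hp])
  refine ⟨Z, i ≫ α.hom, α.inv ≫ e, by simpa using hie, ?_⟩
  rw [Category.assoc, reassoc_of% hei]
  simp

lemma SplitsIdempotents.map {M N : Type*} [Category* M] [Category* N] (F : M ⥤ N) [F.Full]
    [F.Faithful] {X : M} (hX : SplitsIdempotents X) : SplitsIdempotents (F.obj X) := by
  intro p hp
  obtain ⟨p, rfl⟩ := F.map_surjective p
  obtain ⟨Z, i, e, hie, hei⟩ := hX p (F.map_injective (by rw [F.map_comp, hp]))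
  exact ⟨F.obj Z, F.map i, F.map e, by rw [← F.map_comp, hie, F.map_id],
    by rw [← F.map_comp, hei]⟩

/-- If the identity of `X` factors through `X₁` and `X₂` and there is no nonzero morphism from
`X₁` to `X₂`, then idempotents of `X` split if those of `X₁` and `X₂` do. -/
lemma SplitsIdempotents.of_split {M : Type*} [Category* M] [Preadditive M] [HasBinaryBiproducts M]
    {X₁ X X₂ : M} {i : X₁ ⟶ X} {r : X ⟶ X₁} {q : X ⟶ X₂} {s : X₂ ⟶ X}
    (hrs : r ≫ i + q ≫ s = 𝟙 X)
    (h : ∀ f : X₁ ⟶ X₂, f = 0) (h₁ : SplitsIdempotents X₁) (h₂ : SplitsIdempotents X₂) :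
    SplitsIdempotents X := by
  intro p hp
  -- This makes `p` triangular, so its two diagonal entries are idempotent.
  have hipq : i ≫ p ≫ q = 0 := h _
  have hip : i ≫ p = (i ≫ p ≫ r) ≫ i := by
    have := congrArg (fun x ↦ (i ≫ p) ≫ x) hrs
    simp only [Preadditive.comp_add, Category.assoc, Category.comp_id, reassoc_of% hipq, zero_comp,
      add_zero] at this
    simp [this]
  have hpq : p ≫ q = q ≫ (s ≫ p ≫ q) := by
    have := congrArg (fun x ↦ x ≫ p ≫ q) hrs
    simp only [Preadditive.add_comp, Category.assoc, Category.id_comp, hipq, comp_zero,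
      zero_add] at this
    exact this.symm
  obtain ⟨A₁, j₁, p₁, hjp₁, hpj₁⟩ := h₁ (i ≫ p ≫ r) (by
    rw [← Category.assoc (i ≫ p ≫ r), ← hip, Category.assoc, ← Category.assoc p p r, hp])
  obtain ⟨A₂, j₂, p₂, hjp₂, hpj₂⟩ := h₂ (s ≫ p ≫ q) (by
    rw [Category.assoc, Category.assoc, ← hpq, ← Category.assoc p p q, hp])
  have hp' {Z : M} (f : X ⟶ Z) : p ≫ p ≫ f = p ≫ f := by rw [← Category.assoc, hp]
  have hipr {Z : M} (f : X₁ ⟶ Z) : i ≫ p ≫ r ≫ f = p₁ ≫ j₁ ≫ f := by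
    simpa using (congrArg (fun x ↦ x ≫ f) hpj₁).symm
  have hspq {Z : M} (f : X₂ ⟶ Z) : s ≫ p ≫ q ≫ f = p₂ ≫ j₂ ≫ f := by
    simpa using (congrArg (fun x ↦ x ≫ f) hpj₂).symm
  have hip' : i ≫ p = p₁ ≫ j₁ ≫ i := by rw [hip, ← hpj₁, Category.assoc]
  have hpq' {Z : M} (f : X₂ ⟶ Z) : q ≫ p₂ ≫ j₂ ≫ f = p ≫ q ≫ f := by
    rw [← hpj₂] at hpq
    simpa using (congrArg (fun x ↦ x ≫ f) hpq).symm
  let v₁ : A₁ ⟶ X := j₁ ≫ i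
  let u₁ : X ⟶ A₁ := p ≫ r ≫ p₁
  let v₂ : A₂ ⟶ X := j₂ ≫ s ≫ p
  let u₂ : X ⟶ A₂ := p ≫ q ≫ p₂
  have huv₁ : u₁ ≫ v₁ = p ≫ (r ≫ i) ≫ p := by simp [u₁, v₁, hip']
  have huv₂ : u₂ ≫ v₂ = p ≫ (q ≫ s) ≫ p := by simp [u₂, v₂, hpq', hp']
  have hvu₁ : v₁ ≫ u₁ = 𝟙 A₁ := by
    simp [u₁, v₁, hipr, hjp₁]
  have hvu₂ : v₂ ≫ u₂ = 𝟙 A₂ := by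
    simp [u₂, v₂, hp', hspq, hjp₂]
  have hvu₁₂ : v₁ ≫ u₂ = 0 := by
    simp [v₁, u₂, reassoc_of% hipq]
  have hadd : u₁ ≫ v₁ + u₂ ≫ v₂ = p := by
    rw [huv₁, huv₂, ← Preadditive.comp_add, ← Preadditive.add_comp, hrs, Category.id_comp, hp]
  have hpu₁ : p ≫ u₁ = u₁ := hp' _
  have hvu₂₁ : v₂ ≫ u₁ = 0 := by
    -- Composing `hadd` with `u₁` gives `u₁ + u₂ ≫ v₂ ≫ u₁ = u₁`.
    have h₃ : u₂ ≫ v₂ ≫ u₁ = 0 := by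
      have := congrArg (fun x ↦ x ≫ u₁) hadd
      simpa [hvu₁, hpu₁] using this
    simpa [reassoc_of% hvu₂] using congrArg (fun x ↦ v₂ ≫ x) h₃
  refine ⟨A₁ ⊞ A₂, biprod.desc v₁ v₂, biprod.lift u₁ u₂, ?_, by rw [biprod.lift_desc, hadd]⟩
  ext <;> simp [hvu₁, hvu₂, hvu₁₂, hvu₂₁]

namespace Triangulated

open Pretriangulated ZeroObject

variable {𝒯 : Type*} [Category* 𝒯] [Preadditive 𝒯] [HasZeroObject 𝒯] [HasShift 𝒯 ℤ]
  [∀ n : ℤ, (shiftFunctor 𝒯 n).Additive] [Pretriangulated 𝒯]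

lemma splitsIdempotents_of_distTriang {X Y Z : 𝒯} {f : X ⟶ Y} {g : Y ⟶ Z}
    {δ : Z ⟶ X⟦(1 : ℤ)⟧} (hT : Triangle.mk f g δ ∈ distTriang 𝒯) (hδ : δ = 0)
    (h : ∀ k : X ⟶ Z, k = 0) (hX : SplitsIdempotents X) (hZ : SplitsIdempotents Z) :
    SplitsIdempotents Y := by
  have hfg : f ≫ g = 0 := comp_distTriang_mor_zero₁₂ _ hT
  obtain ⟨s, hs⟩ := exists_lift₃ hT (𝟙 Z) (by rw [hδ, comp_zero])
  obtain ⟨r, hr⟩ := exists_lift₂ hT (𝟙 Y - g ≫ s) (by simp [Preadditive.sub_comp, hs])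
  exact SplitsIdempotents.of_split (by rw [hr, sub_add_cancel]) h hX hZ

namespace TStructure

variable {t : TStructure 𝒯}

/-- Induction on the width: heredity splits off the lowest degree, which has no nonzero map to the
rest. -/
lemma splitsIdempotents (ht : t.IsHereditary)
    (h : ∀ (X : 𝒯) (n : ℤ), t.IsGE X n → t.IsLE X n → SplitsIdempotents X) (X : 𝒯)
    (a : ℤ) (m : ℕ) (hX : t.IsGE X a) (hX' : t.IsLE X (a + m)) : SplitsIdempotents X := by
  induction m generalizing X a with
  | zero => exact h X a hX (by simpa using hX')
  | succ m ih =>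
    obtain ⟨A₁, A₂, h₁, h₂, i, q, δ, hT⟩ := t.exists_triangle X a (a + 1) rfl
    have h₁ : t.IsLE A₁ a := ⟨h₁⟩
    have h₂ : t.IsGE A₂ (a + 1) := ⟨h₂⟩
    have h₁' : t.IsGE A₁ a := isGE_obj₁ hT _ hX (t.isGE_of_ge A₂ _ (a + 1))
    have h₂' : t.IsLE A₂ (a + (m + 1 : ℕ)) := isLE_obj₃ hT _ (t.isLE_of_le A₁ a _) hX'
    have hδ : δ = 0 := ht δ a (a - 1) _ h₂ h₂' (t.isLE_shift A₁ a 1 (a - 1))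
      (t.isGE_shift A₁ a 1 (a - 1))
    refine splitsIdempotents_of_distTriang hT hδ (fun k ↦ t.zero k a (a + 1)) (h A₁ a h₁' h₁)
      (ih A₂ (a + 1) h₂ ?_)
    convert h₂' using 1
    push_cast
    ring

/-- A t-structure is hereditary if there is no nonzero morphism between objects that are
concentrated in degrees `p` and `q` with `q ≤ p - 2`. -/
lemma isHereditary_of_concentrated
    (h : ∀ ⦃X Y : 𝒯⦄ (f : X ⟶ Y) (p q : ℤ), q + 2 ≤ p → t.IsGE X p → t.IsLE X p →
      t.IsGE Y q → t.IsLE Y q → f = 0) : t.IsHereditary := by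
  have hLeft (k : ℕ) : ∀ ⦃X Y : 𝒯⦄ (f : X ⟶ Y) (p q : ℤ), q + 2 ≤ p → t.IsGE X p →
      t.IsLE X (p + k) → t.IsGE Y q → t.IsLE Y q → f = 0 := by
    induction k with
    | zero =>
      intro X Y f p q hpq hX hX' hY hY'
      exact h f p q hpq hX (by simpa using hX') hY hY'
    | succ k ih =>
      intro X Y f p q hpq hX hX' hY hY'
      obtain ⟨A₁, A₂, h₁, h₂, i, j, δ, hT⟩ := t.exists_triangle X p (p + 1) rfl
      have h₁ : t.IsLE A₁ p := ⟨h₁⟩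
      have h₂ : t.IsGE A₂ (p + 1) := ⟨h₂⟩
      have h₁' : t.IsGE A₁ p := isGE_obj₁ hT _ hX (t.isGE_of_ge A₂ _ (p + 1))
      have h₂' : t.IsLE A₂ (p + (k + 1 : ℕ)) := isLE_obj₃ hT _ (t.isLE_of_le A₁ p _) hX'
      obtain ⟨f, rfl⟩ := exists_desc₂ hT f (h _ p q hpq h₁' h₁ hY hY')
      rw [ih f (p + 1) q (by lia) h₂ (t.isLE_of_le A₂ (p + (k + 1 : ℕ)) _) hY hY', comp_zero]
  -- The gap is measured from the top degree `q + l` of the target.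
  have hBoth (l : ℕ) : ∀ (k : ℕ) ⦃X Y : 𝒯⦄ (f : X ⟶ Y) (p q : ℤ), q + l + 2 ≤ p → t.IsGE X p →
      t.IsLE X (p + k) → t.IsGE Y q → t.IsLE Y (q + l) → f = 0 := by
    induction l with
    | zero =>
      intro k X Y f p q hpq hX hX' hY hY'
      exact hLeft k f p q (by lia) hX hX' hY (by simpa using hY')
    | succ l ih =>
      intro k X Y f p q hpq hX hX' hY hY'
      obtain ⟨A₁, A₂, h₁, h₂, i, j, δ, hT⟩ := t.exists_triangle Y q (q + 1) rfl
      have h₁ : t.IsLE A₁ q := ⟨h₁⟩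
      have h₂ : t.IsGE A₂ (q + 1) := ⟨h₂⟩
      have h₁' : t.IsGE A₁ q := isGE_obj₁ hT _ hY (t.isGE_of_ge A₂ _ (q + 1))
      have h₂' : t.IsLE A₂ (q + (l + 1 : ℕ)) := isLE_obj₃ hT _ (t.isLE_of_le A₁ q _) hY'
      obtain ⟨f, rfl⟩ := exists_lift₂ hT f (ih k _ p (q + 1) (by lia) hX hX' h₂
        (t.isLE_of_le A₂ (q + (l + 1 : ℕ)) _))
      rw [hLeft k f p q (by lia) hX hX' h₁' h₁, zero_comp]
  intro X Y f n a b hX hX' hY hY'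
  -- If `b < n + 1` or `a > n - 1`, `toNat` returns width `0` and the bound is merely weakened.
  have := t.isLE_of_le X b (n + 1 + (b - n - 1).toNat)
  have := t.isGE_of_ge Y (n - 1 - (n - 1 - a).toNat) a
  exact hBoth (n - 1 - a).toNat (b - n - 1).toNat f (n + 1) (n - 1 - (n - 1 - a).toNat)
    (by lia) hX ‹_› ‹_› (by rwa [sub_add_cancel])

variable {M : Type*} [Category* M] {ι : M ⥤ 𝒯} [ι.Full] [ι.Faithful] {a : ℤ} {m : ℕ}

lemma isIdempotentComplete (ht : t.IsHereditary)
    (h : ∀ (X : 𝒯) (n : ℤ), t.IsGE X n → t.IsLE X n → SplitsIdempotents X)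
    (hι : ∀ A, ι.essImage A ↔ t.IsGE A a ∧ t.IsLE A (a + m)) : IsIdempotentComplete M where
  idempotents_split X p hp := by
    obtain ⟨hX, hX'⟩ := (hι _).1 (ι.obj_mem_essImage X)
    obtain ⟨Y, i, e, hie, hei⟩ := t.splitsIdempotents ht h _ a m hX hX' (ι.map p)
      (by rw [← ι.map_comp, hp])
    -- Both bounds are orthogonality conditions, so they pass to retracts.
    have hY : ι.essImage Y := by
      refine (hι Y).2 ⟨?_, ?_⟩
      · rw [t.isGE_iff_orthogonal (a - 1) a (by lia)]
        intro Z f hZ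
        rw [← Category.comp_id f, ← hie, ← Category.assoc, t.zero (f ≫ i) (a - 1) a, zero_comp]
      · rw [t.isLE_iff_orthogonal (a + m) (a + m + 1) rfl]
        intro Z f hZ
        rw [← Category.id_comp f, ← hie, Category.assoc, t.zero (e ≫ f) (a + m) (a + m + 1),
          comp_zero]
    obtain ⟨Y', ⟨α⟩⟩ := hY
    obtain ⟨i', hi'⟩ := ι.map_surjective (α.hom ≫ i)
    obtain ⟨e', he'⟩ := ι.map_surjective (e ≫ α.inv)
    refine ⟨Y', i', e', ι.map_injective ?_, ι.map_injective ?_⟩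
    · rw [ι.map_comp, hi', he', Category.assoc, reassoc_of% hie, α.hom_inv_id, ι.map_id]
    · rw [ι.map_comp, hi', he', Category.assoc, α.inv_hom_id_assoc, hei]

lemma hasFiniteBiproducts [Preadditive M] [ι.Additive]
    (hι : ∀ A, ι.essImage A ↔ t.IsGE A a ∧ t.IsLE A (a + m)) : HasFiniteBiproducts M := by
  have h0 : HasZeroObject M := by
    obtain ⟨Z, ⟨α⟩⟩ := (hι (0 : 𝒯)).2 ⟨inferInstance, inferInstance⟩
    refine ⟨Z, ?_⟩
    rw [IsZero.iff_id_eq_zero]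
    refine ι.map_injective ?_
    rw [ι.map_id, ι.map_zero]
    exact ((isZero_zero 𝒯).of_iso α).eq_of_src _ _
  have h2 : HasBinaryBiproducts M := by
    constructor
    intro A B
    obtain ⟨hA, hA'⟩ := (hι _).1 (ι.obj_mem_essImage A)
    obtain ⟨hB, hB'⟩ := (hι _).1 (ι.obj_mem_essImage B)
    obtain ⟨P, ⟨α⟩⟩ := (hι (ι.obj A ⊞ ι.obj B)).2
      ⟨t.isGE₂ _ (binaryBiproductTriangle_distinguished _ _) a hA hB,
        t.isLE₂ _ (binaryBiproductTriangle_distinguished _ _) (a + m) hA' hB'⟩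
    obtain ⟨fst, hfst⟩ := ι.map_surjective (α.hom ≫ biprod.fst)
    obtain ⟨snd, hsnd⟩ := ι.map_surjective (α.hom ≫ biprod.snd)
    obtain ⟨inl, hinl⟩ := ι.map_surjective (biprod.inl ≫ α.inv)
    obtain ⟨inr, hinr⟩ := ι.map_surjective (biprod.inr ≫ α.inv)
    let c : BinaryBicone A B :=
      { pt := P
        fst := fst
        snd := snd
        inl := inl
        inr := inr
        inl_fst := ι.map_injective (by simp [hfst, hinl])
        inl_snd := ι.map_injective (by simp [hsnd, hinl])
        inr_fst := ι.map_injective (by simp [hfst, hinr])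
        inr_snd := ι.map_injective (by simp [hsnd, hinr]) }
    refine hasBinaryBiproduct_of_total c (ι.map_injective ?_)
    change ι.map (fst ≫ inl + snd ≫ inr) = ι.map (𝟙 P)
    rw [ι.map_add, ι.map_comp, ι.map_comp, hfst, hsnd, hinl, hinr, ι.map_id,
      ← cancel_epi α.inv, ← cancel_mono α.hom]
    simp
  have := hasFiniteProducts_of_has_binary_and_terminal (C := M)
  exact HasFiniteBiproducts.of_hasFiniteProducts

/-- The objects of a hereditary triangulated category that are between `a` and `a + m` form
a `(3m + 1)`-abelian category. -/
theorem isDAbelian [Preadditive M] [ι.Additive] (ht : t.IsHereditary)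
    (h : ∀ (X : 𝒯) (n : ℤ), t.IsGE X n → t.IsLE X n → SplitsIdempotents X)
    (hι : ∀ A, ι.essImage A ↔ t.IsGE A a ∧ t.IsLE A (a + m)) : IsDAbelian (3 * m + 1) M where
  pos := by lia
  hasFiniteBiproducts := hasFiniteBiproducts hι
  idempotentComplete := isIdempotentComplete ht h hι
  exists_dKernel := exists_isDKernelSeq hι
  exists_dCokernel := exists_isDCokernelSeq hι
  isDExactSeq_of_mono S hf hS := ⟨hS, isDKernelSeq_of_mono ht hι S hf hS⟩
  isDExactSeq_of_epi S hf hS := ⟨isDCokernelSeq_of_epi ht hι S hf hS, hS⟩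

end TStructure

end Triangulated

end CategoryTheory

/-! ### The derived category of a hereditary abelian category -/

namespace DerivedCategory

open Triangulated TStructure

variable {C : Type u} [Category.{v} C] [Abelian C] [HasDerivedCategory.{w} C]

lemma splitsIdempotents_of_isGE_of_isLE (X : DerivedCategory C) (n : ℤ) [X.IsGE n] [X.IsLE n] :
    SplitsIdempotents X := by
  obtain ⟨A, ⟨α⟩⟩ := X.exists_iso_singleFunctor_obj_of_isGE_of_isLE n
  have hA : SplitsIdempotents A := IsIdempotentComplete.idempotents_split A
  exact (hA.map (singleFunctor C n)).of_iso α.symm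

/-- Shifting by `p = q + 2 + k` moves `A` to degree `0` and `B` to degree `-(k + 2)`, turning `f`
into a class in `Ext^{k + 2}(A, B)`. -/
lemma singleFunctor_hom_eq_zero (hC : IsHereditary C) {A B : C} {p q : ℤ} (hpq : q + 2 ≤ p)
    (f : (singleFunctor C p).obj A ⟶ (singleFunctor C q).obj B) : f = 0 := by
  let _ : HasExt.{max u v} C := HasExt.standard C
  obtain ⟨k, rfl⟩ := Int.le.dest hpq
  have := hC A B (k + 2) (by lia)
  have hs : Subsingleton ((singleFunctor C 0).obj A ⟶
      ((singleFunctor C 0).obj B)⟦((k + 2 : ℕ) : ℤ)⟧) :=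
    (Abelian.Ext.homEquiv (X := A) (Y := B) (n := k + 2)).symm.subsingleton
  let α := ((singleFunctors C).shiftIso (q + 2 + k) 0 (q + 2 + k) (by lia)).app A
  let β := ((singleFunctors C).shiftIso (q + 2 + k) (-(k + 2 : ℕ)) q (by push_cast; lia)).app B
  let γ := ((singleFunctors C).shiftIso (k + 2 : ℕ) (-(k + 2 : ℕ)) 0 (by lia)).app B
  refine (shiftFunctor (DerivedCategory C) (q + 2 + k)).map_injective ?_
  have h : α.inv ≫ f⟦q + 2 + (k : ℤ)⟧' ≫ β.hom ≫ γ.inv = 0 := hs.elim _ _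
  have h' : f⟦q + 2 + (k : ℤ)⟧' = α.hom ≫ (α.inv ≫ f⟦q + 2 + (k : ℤ)⟧' ≫ β.hom ≫ γ.inv) ≫
      γ.hom ≫ β.inv := by
    simp
  rw [h', h, zero_comp, comp_zero, Functor.map_zero]

lemma isHereditary_t (hC : IsHereditary C) : (t : TStructure (DerivedCategory C)).IsHereditary := by
  refine isHereditary_of_concentrated ?_
  intro X Y f p q hpq _ _ _ _
  obtain ⟨A, ⟨α⟩⟩ := X.exists_iso_singleFunctor_obj_of_isGE_of_isLE p
  obtain ⟨B, ⟨β⟩⟩ := Y.exists_iso_singleFunctor_obj_of_isGE_of_isLE q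
  rw [← cancel_epi α.inv, ← cancel_mono β.hom, comp_zero, zero_comp]
  exact singleFunctor_hom_eq_zero hC hpq _

end DerivedCategory

/-- Homological degrees `0, …, m` are cohomological degrees `-m, …, 0`, so `a = -m`; the top `0` is
written `-m + m` to match `a + m`. -/
lemma truncatedCategory_essImage_iff {C : Type u} [Category.{v} C] [Abelian C]
    [HasDerivedCategory.{w} C] (m : ℕ) (A : DerivedCategory C) :
    ((homologyConcentrated C 0 m).ι ⋙ DerivedCategory.Bounded.ι).essImage A ↔
      A.IsGE (-m) ∧ A.IsLE (-m + m) := by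
  rw [neg_add_cancel]
  constructor
  · rintro ⟨⟨B, hB⟩, ⟨e⟩⟩
    have hB' (n : ℤ) (hn : ¬ (-m ≤ n ∧ n ≤ 0)) :
        IsZero ((DerivedCategory.homologyFunctor C n).obj A) := by
      have := hB (-n) (by lia)
      rw [neg_neg] at this
      exact this.of_iso ((DerivedCategory.homologyFunctor C n).mapIso e.symm)
    rw [DerivedCategory.isGE_iff, DerivedCategory.isLE_iff]
    exact ⟨fun i hi ↦ hB' i (by lia), fun i hi ↦ hB' i (by lia)⟩
  · rintro ⟨h, h'⟩
    refine ⟨⟨⟨A, ⟨⟨_, h⟩, ⟨_, h'⟩⟩⟩, fun s hs ↦ ?_⟩, ⟨Iso.refl _⟩⟩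
    rw [DerivedCategory.isGE_iff] at h
    rw [DerivedCategory.isLE_iff] at h'
    by_cases hs' : 0 ≤ s
    · exact h _ (by lia)
    · exact h' _ (by lia)

theorem theoremA {C : Type u} [Category.{v} C] [Abelian C] [HasDerivedCategory.{w} C]
    (hC : IsHereditary C) (m : ℕ) :
    IsDAbelian (3 * m + 1) (TruncatedCategory C 0 (m : ℤ)) := by
  exact Triangulated.TStructure.isDAbelian (DerivedCategory.isHereditary_t hC)
    (fun X n _ _ ↦ X.splitsIdempotents_of_isGE_of_isLE n) (truncatedCategory_essImage_iff m)
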